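/- Let $d\ge 2$, let $F_1,F_2,G$ be finite-dimensional complex normed spaces, and let $m(\xi,\eta)$, for $(\xi,\eta)\in\mathbb R^d\times\mathbb R^d$, take values in the bilinear maps $F_1\times F_2\to G$, with $|\cdot|$ denoting the norm $|b|=\sup\{\|b(u,v)\|_G:\|u\|_{F_1}\le1,\ \|v\|_{F_2}\le 1\}$. For $f:\mathbb R^d\to F_1$ and $g:\mathbb R^d\to F_2$ put $$\mathcal N(f,g)(x)=\int e^{i x\cdot(\xi+\eta)}\,m(\xi,\eta)\big(\hat f(\xi),\hat g(\eta)\big)\,\frac{d\xi\,d\eta}{(2\pi)^{2d}},\qquad \hat f(\xi)=\int e^{-ix\cdot\xi}f(x)\,dx .$$ For nonzero $\xi,\eta$ let $|\angle(\xi,\eta)|\in[0,\pi]$ be the angle between $\xi$ and $\eta$, and write $S_\xi=\xi\cdot\partial_\xi$, $S_\eta=\eta\cdot\partial_\eta$. Suppose that $\mathcal N$ is an abstract null form of order $1$ with constants $A=\big((A_{n_1,n_2}),(A_{\alpha_1,\alpha_2})\big)$, that is, $m$ is smooth on $\{\xi\ne0,\ \eta\neq 0\}$ and there $$|S_\xi^{n_1}S_\eta^{n_2}m(\xi,\eta)|\le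 A_{n_1,n_2}\,|\angle(\xi,\eta)|,\qquad |\partial_\xi^{\alpha_1}\partial_\eta^{\alpha_2}m(\xi,\eta)|\le A_{\alpha_1,\alpha_2}\,|\xi|^{-|\alpha_1|}|\eta|^{-|\alpha_2|}$$ for all integers $n_1,n_2\ge0$ and all multi-indices $\alpha_1,\alpha_2$. Let $\omega_1,\omega_2\subseteq\mathbb S^{d-1}$ be angular caps (geodesic balls, open or closed) of radii $0<r_1,r_2\le 2^{-10}$, and define $$\theta:=\max\{|\angle(\omega_1,\omega_2)|,r_1,r_2\},\qquad |\angle(\omega_1,\omega_2)|:=\inf\{|\angle(\xi,\eta)|:\xi\in\omega_1,\ \eta\in\omega_2\}.$$ Let $k_1,k_2\in\mathbb Z$ and let $f_1:\mathbb R^d\to F_1$, $f_2:\mathbb R^d\to F_2$ be Schwartz functions such that, for $j=1,2$, $$\operatorname{supp}\hat f_j\subseteq E_j:=\Big\{\tfrac1{100}2^{k_j}<|\xi|<100\cdot 2^{k_j},\ \tfrac{\xi}{|\xi|}\in\omega_j\Big\}.$$ Then for all $1\le p,q_1,q_2\le\infty$ with $p^{-1}=q_1^{-1}+q_2^{-1}$,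 $$\|\mathcal N(f_1,f_2)\|_{L^p}\le C\,\theta\,\|f_1\|_{L^{q_1}}\|f_2\|_{L^{q_2}},$$ where the constant $C$ depends only on $d$ and $A$. -/

import Mathlib

open MeasureTheory SchwartzMap
open scoped ContDiff ENNReal

noncomputable section

namespace NullForm

/-- The Euclidean space `ℝ^d`. -/
abbrev Rd (d : ℕ) : Type := EuclideanSpace ℝ (Fin d)

section Symbols

variable {d : ℕ} {H : Type*} [NormedAddCommGroup H] [NormedSpace ℝ H]

/-- The radial vector field `S_ξ = ξ · ∂_ξ` acting on functions `m(ξ, η)`. -/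
def radialLeft (m : Rd d × Rd d → H) : Rd d × Rd d → H :=
  fun z => fderiv ℝ m z (z.1, 0)

/-- The radial vector field `S_η = η · ∂_η` acting on functions `m(ξ, η)`. -/
def radialRight (m : Rd d × Rd d → H) : Rd d × Rd d → H :=
  fun z => fderiv ℝ m z (0, z.2)

/-- The partial derivative `∂/∂ξ_i` of `m(ξ, η)`. -/
def partialLeft (i : Fin d) (m : Rd d × Rd d → H) : Rd d × Rd d → H :=
  fun z => fderiv ℝ m z (EuclideanSpace.single i 1, 0)

/-- The partial derivative `∂/∂η_i` of `m(ξ, η)`. -/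
def partialRight (i : Fin d) (m : Rd d × Rd d → H) : Rd d × Rd d → H :=
  fun z => fderiv ℝ m z (0, EuclideanSpace.single i 1)

/-- `∂_ξ^α = ∂_{ξ_1}^{α_1} ⋯ ∂_{ξ_d}^{α_d}` for a multi-index `α`. -/
def multiLeft (α : Fin d → ℕ) (m : Rd d × Rd d → H) : Rd d × Rd d → H :=
  (List.finRange d).foldr (fun i g => (partialLeft i)^[α i] g) m

/-- `∂_η^β = ∂_{η_1}^{β_1} ⋯ ∂_{η_d}^{β_d}` for a multi-index `β`. -/
def multiRight (β : Fin d → ℕ) (m : Rd d × Rd d → H) : Rd d × Rd d → H :=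
  (List.finRange d).foldr (fun i g => (partialRight i)^[β i] g) m

/-- `m` is the symbol of an abstract null form of order `1`, with constants
`A n₁ n₂` (in the angular bounds) and `B α β` (in the derivative bounds).
The symbol is smooth where `ξ ≠ 0` and `η ≠ 0`, and the bounds are required there. -/
structure IsAbstractNullForm (A : ℕ → ℕ → ℝ) (B : (Fin d → ℕ) → (Fin d → ℕ) → ℝ)
    (m : Rd d × Rd d → H) : Prop where
  smooth : ContDiffOn ℝ ∞ m {z | z.1 ≠ 0 ∧ z.2 ≠ 0}
  angle_bound : ∀ (n₁ n₂ : ℕ) (ξ η : Rd d), ξ ≠ 0 → η ≠ 0 →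
    ‖(radialLeft^[n₁] (radialRight^[n₂] m)) (ξ, η)‖ ≤ A n₁ n₂ * InnerProductGeometry.angle ξ η
  deriv_bound : ∀ (α β : Fin d → ℕ) (ξ η : Rd d), ξ ≠ 0 → η ≠ 0 →
    ‖multiLeft α (multiRight β m) (ξ, η)‖ ≤
      B α β * (‖ξ‖ ^ (∑ i, α i))⁻¹ * (‖η‖ ^ (∑ i, β i))⁻¹

end Symbols

section Operators

variable {d : ℕ} {F₁ F₂ G : Type*}
  [NormedAddCommGroup F₁] [NormedSpace ℂ F₁]
  [NormedAddCommGroup F₂] [NormedSpace ℂ F₂]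
  [NormedAddCommGroup G] [NormedSpace ℂ G]

/-- The Fourier transform `f̂(ξ) = ∫ e^{-i x·ξ} f(x) dx`. -/
def hat (f : Rd d → F₁) (ξ : Rd d) : F₁ :=
  ∫ x : Rd d, Complex.exp (-(Complex.I * ((inner ℝ x ξ : ℝ) : ℂ))) • f x

/-- The translation-invariant bilinear operator with symbol `m`,
`N(f, g)(x) = (2π)^{-2d} ∫∫ e^{i x·(ξ+η)} m(ξ, η)(f̂(ξ), ĝ(η)) dξ dη`. The symbol takes values in
the bounded bilinear maps `F₁ × F₂ → G`. -/
def bilinearOp (m : Rd d × Rd d → (F₁ →L[ℂ] F₂ →L[ℂ] G)) (f : Rd d → F₁) (g : Rd d → F₂)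
    (x : Rd d) : G :=
  (((2 * Real.pi) ^ (2 * d))⁻¹ : ℝ) •
    ∫ z : Rd d × Rd d,
      Complex.exp (Complex.I * ((inner ℝ x (z.1 + z.2) : ℝ) : ℂ)) • m z (hat f z.1) (hat g z.2)

end Operators

/-- `Ω` is an angular cap of radius `r`: a geodesic ball (open or closed) on the unit sphere. The
geodesic distance of two unit vectors is the angle between them. -/
def IsAngularCap {d : ℕ} (Ω : Set (Rd d)) (r : ℝ) : Prop :=
  0 < r ∧ ∃ p : Rd d, ‖p‖ = 1 ∧
    (Ω = {x | ‖x‖ = 1 ∧ InnerProductGeometry.angle p x < r} ∨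
      Ω = {x | ‖x‖ = 1 ∧ InnerProductGeometry.angle p x ≤ r})

/-- The angular distance `|∠(S, T)| = inf {|∠(ξ, η)| : ξ ∈ S, η ∈ T}`. -/
def angularDist {d : ℕ} (S T : Set (Rd d)) : ℝ :=
  sInf {a | ∃ ξ ∈ S, ∃ η ∈ T, a = InnerProductGeometry.angle ξ η}

/-- The sector `{2^k / 100 < |ξ| < 100 · 2^k, ξ / |ξ| ∈ Ω}`. -/
def sector {d : ℕ} (k : ℤ) (Ω : Set (Rd d)) : Set (Rd d) :=
  {ξ | 1 / 100 * (2 : ℝ) ^ k < ‖ξ‖ ∧ ‖ξ‖ < 100 * (2 : ℝ) ^ k ∧ ‖ξ‖⁻¹ • ξ ∈ Ω}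

end NullForm

end

/-!
# The bilinear estimate for null forms with angularly localized inputs

After multiplication by a cutoff, a symbol is a superposition `m(ξ, η) = ∫ e^{i(a(w)·ξ + b(w)·η)}
K(w) dw` of characters on the frequency supports of the two inputs. The operator is then the
average `∫ K(w)(f(x + a(w)), g(x + b(w))) dw` of products of translates
(`bilinearOp_eq_integral`), so by Minkowski and Hölder its norm is at most `‖K‖_{L¹}`
(`eLpNorm_integral_translates_le`). It remains to find such a kernel with `‖K‖_{L¹} = O(θ)`.

Let `p_j` be the centre of the `j`-th cap, and let `T_j` be the linear map that takes a region of
unit size around a fixed axis `e` to the sector: it sends `e` to `2^{k_j} p_j` and multiplies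
lengths orthogonal to `e` by `2^{k_j} θ` (`sectorMap`). The kernel of the rescaled symbol `M(x, y)
= m(T₁ x, T₂ y)`, cut off to a fixed compact region, is integrable with norm `O(Λ)`, where `Λ`
bounds finitely many derivatives of `M` (`exists_kernel`). Passing from `M` back to `m` only
changes the functions `a` and `b`, so no change of variables is needed. The cutoff is the same for
all caps and scales, and the case of large `θ` needs no separate treatment.

The heart of the matter is that all derivatives of `M` are `O(θ)`
(`exists_norm_iteratedFDeriv_le_mul`). On the region in question `x` has a component of size `≈ 1`
along `e`, so every vector is a bounded multiple of `x` plus a vector orthogonal to `e`, which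
`T_j` shrinks by the factor `θ`. Expanding a derivative of `M` accordingly, each term that
contains an orthogonal vector is `O(θ)` by the bounds on the partial derivatives of `m`
(`exists_norm_iteratedFDeriv_le`). The only other term consists of derivatives in the radial
directions `(ξ, 0)` and `(0, η)`, and is a polynomial in `S_ξ` and `S_η` applied to `m`
(`exists_norm_lieWord_radialDeriv_le`). It is `O(∠(ξ, η))` by the angular bounds, hence `O(θ)`,
since both points lie within an angle `O(θ)` of the centres and the centres are at angle at most
`3θ`. The Euler fields `S_ξ`, `S_η` are invariant under linear maps, so this argument is not
disturbed by the anisotropic rescaling.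
-/

noncomputable section

namespace NullForm

/-! ### Averages of translates in Lebesgue spaces -/

/-- Jensen's inequality for the measure `k dμ`. -/
theorem lintegral_mul_rpow_le {α : Type*} [MeasurableSpace α] {μ : Measure α} {k g : α → ℝ≥0∞}
    (hk : AEMeasurable k μ) (hg : AEMeasurable g μ) {p : ℝ} (hp : 1 ≤ p) :
    (∫⁻ a, k a * g a ∂μ) ^ p ≤ (∫⁻ a, k a ∂μ) ^ (p - 1) * ∫⁻ a, k a * g a ^ p ∂μ := by
  rcases hp.eq_or_lt with rfl | hp
  · simp
  have hp0 : 0 < p := by linarith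
  have hpq := (Real.HolderConjugate.conjExponent hp).symm
  set q := p.conjExponent with hq
  have hq0 : 0 < q := hpq.pos
  have h := ENNReal.lintegral_mul_le_Lp_mul_Lq μ hpq (hk.pow_const (1 / q))
    ((hk.pow_const (1 / p)).mul hg)
  have e1 : ∀ a, ((fun a => k a ^ (1 / q)) * ((fun a => k a ^ (1 / p)) * g)) a = k a * g a := by
    intro a
    have : (1 / q) + (1 / p) = 1 := by simpa using hpq.inv_add_inv_eq_one
    simp only [Pi.mul_apply]
    rw [← mul_assoc, ← ENNReal.rpow_add_of_nonneg _ _ (by positivity) (by positivity), this,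
      ENNReal.rpow_one]
  have e2 : ∀ a, (k a ^ (1 / q)) ^ q = k a := by
    intro a; rw [← ENNReal.rpow_mul, one_div_mul_cancel hq0.ne', ENNReal.rpow_one]
  have e3 : ∀ a, (((fun a => k a ^ (1 / p)) * g) a) ^ p = k a * g a ^ p := by
    intro a
    simp only [Pi.mul_apply]
    rw [ENNReal.mul_rpow_of_nonneg _ _ hp0.le, ← ENNReal.rpow_mul, one_div_mul_cancel hp0.ne',
      ENNReal.rpow_one]
  simp only [e1, e2, e3] at h
  calc _ ≤ _ := ENNReal.rpow_le_rpow h hp0.le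
    _ = _ := by
      rw [ENNReal.mul_rpow_of_nonneg _ _ hp0.le, ← ENNReal.rpow_mul, ← ENNReal.rpow_mul,
        one_div_mul_cancel hp0.ne', ENNReal.rpow_one]
      congr 2
      rw [hq, Real.conjExponent]
      field_simp

/-- Minkowski's integral inequality for a family `g · w` that is uniformly bounded in `L^p`. -/
theorem lintegral_rpow_lintegral_mul_le {α β : Type*} [MeasurableSpace α] [MeasurableSpace β]
    {μ : Measure α} {ν : Measure β} [SFinite μ] [SFinite ν] {k : α → ℝ≥0∞} {g : β → α → ℝ≥0∞}
    (hk : Measurable k) (hg : Measurable (Function.uncurry g)) {p : ℝ} (hp : 1 ≤ p) {c : ℝ≥0∞}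
    (h : ∀ w, ∫⁻ x, g x w ^ p ∂ν ≤ c ^ p) :
    ∫⁻ x, (∫⁻ w, k w * g x w ∂μ) ^ p ∂ν ≤ ((∫⁻ w, k w ∂μ) * c) ^ p := by
  have hp0 : 0 < p := by linarith
  calc ∫⁻ x, (∫⁻ w, k w * g x w ∂μ) ^ p ∂ν
      ≤ ∫⁻ x, (∫⁻ w, k w ∂μ) ^ (p - 1) * ∫⁻ w, k w * g x w ^ p ∂μ ∂ν :=
        lintegral_mono fun x => lintegral_mul_rpow_le hk.aemeasurable
          (hg.comp measurable_prodMk_left).aemeasurable hp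
    _ = (∫⁻ w, k w ∂μ) ^ (p - 1) * ∫⁻ w, ∫⁻ x, k w * g x w ^ p ∂ν ∂μ := by
        have hm : Measurable (Function.uncurry fun x w => k w * g x w ^ p) :=
          (hk.comp measurable_snd).mul (hg.pow_const p)
        have hm' : Measurable fun x => ∫⁻ w, k w * g x w ^ p ∂μ := hm.lintegral_prod_right'
        rw [lintegral_const_mul _ hm', lintegral_lintegral_swap hm.aemeasurable]
    _ ≤ (∫⁻ w, k w ∂μ) ^ (p - 1) * ∫⁻ w, k w * c ^ p ∂μ := by
        gcongr with w
        have hm' : Measurable fun x => g x w ^ p := (hg.comp measurable_prodMk_right).pow_const p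
        rw [lintegral_const_mul _ hm']
        gcongr
        exact h w
    _ = ((∫⁻ w, k w ∂μ) * c) ^ p := by
        rw [lintegral_mul_const _ hk, ENNReal.mul_rpow_of_nonneg _ _ hp0.le, ← mul_assoc]
        congr 1
        nth_rewrite 2 [← ENNReal.rpow_one (∫⁻ w, k w ∂μ)]
        rw [← ENNReal.rpow_add_of_nonneg _ _ (by linarith) zero_le_one, sub_add_cancel]

theorem enorm_le_eLpNorm_top_of_continuous {X E : Type*} [TopologicalSpace X] [MeasurableSpace X]
    [OpensMeasurableSpace X] {μ : Measure X} [μ.IsOpenPosMeasure] [NormedAddCommGroup E]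
    {f : X → E} (hf : Continuous f) (x : X) : ‖f x‖ₑ ≤ eLpNorm f (⊤ : ℝ≥0∞) μ := by
  by_contra! h
  have hopen : IsOpen {y | eLpNorm f (⊤ : ℝ≥0∞) μ < ‖f y‖ₑ} := isOpen_lt continuous_const hf.enorm
  have hzero : μ {y | eLpNorm f (⊤ : ℝ≥0∞) μ < ‖f y‖ₑ} = 0 := by
    have := enorm_ae_le_eLpNormEssSup f μ
    rw [← eLpNorm_exponent_top, ae_iff] at this
    simpa using this
  rw [hopen.measure_eq_zero_iff μ] at hzero
  exact (Set.eq_empty_iff_forall_notMem.1 hzero x) h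

section Bilinear

variable {d : ℕ} {H F₁ F₂ G : Type*}
  [NormedAddCommGroup H] [NormedSpace ℂ H]
  [NormedAddCommGroup F₁] [NormedSpace ℂ F₁]
  [NormedAddCommGroup F₂] [NormedSpace ℂ F₂]
  [NormedAddCommGroup G] [NormedSpace ℂ G]

/-- An average of products of translates of `f` and `g` against an operator-valued kernel `K`
obeys Hölder's inequality, with the `L¹` norm of `K` as its constant. -/
theorem eLpNorm_integral_translates_le {W : Type*} [MeasurableSpace W] [TopologicalSpace W]
    [OpensMeasurableSpace W] {μ : Measure W} [SFinite μ] {K : W → H}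
    (hK : Continuous K) {T : H →L[ℂ] F₁ →L[ℂ] F₂ →L[ℂ] G}
    (hT : ∀ h u v, ‖T h u v‖ ≤ ‖h‖ * ‖u‖ * ‖v‖) {a b : W → Rd d} (ha : Measurable a)
    (hb : Measurable b)
    {f : Rd d → F₁} {g : Rd d → F₂} (hf : Continuous f) (hg : Continuous g)
    {p q₁ q₂ : ℝ≥0∞} (hp : 1 ≤ p) (hpq : p⁻¹ = q₁⁻¹ + q₂⁻¹) :
    eLpNorm (fun x => ∫ w, T (K w) (f (x + a w)) (g (x + b w)) ∂μ) p volume ≤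
      (∫⁻ w, ‖K w‖ₑ ∂μ) * (eLpNorm f q₁ volume * eLpNorm g q₂ volume) := by
  have hpt : ∀ x, ‖∫ w, T (K w) (f (x + a w)) (g (x + b w)) ∂μ‖ₑ ≤
      ∫⁻ w, ‖K w‖ₑ * (‖f (x + a w)‖ₑ * ‖g (x + b w)‖ₑ) ∂μ := by
    intro x
    refine (enorm_integral_le_lintegral_enorm _).trans (lintegral_mono fun w => ?_)
    rw [← mul_assoc]
    simpa [← ofReal_norm, ENNReal.ofReal_mul, mul_nonneg] using
      ENNReal.ofReal_le_ofReal (hT (K w) (f (x + a w)) (g (x + b w)))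
  have hKm : Measurable fun w => ‖K w‖ₑ := hK.enorm.measurable
  rcases eq_or_ne p (⊤ : ℝ≥0∞) with rfl | hp_top
  · obtain ⟨h1, h2⟩ : q₁ = ⊤ ∧ q₂ = ⊤ := by
      have : q₁⁻¹ = 0 ∧ q₂⁻¹ = 0 := by simpa using hpq.symm
      simpa using this
    subst h1 h2
    rw [eLpNorm_exponent_top]
    refine eLpNormEssSup_le_of_ae_enorm_bound (ae_of_all _ fun x => (hpt x).trans ?_)
    rw [← lintegral_mul_const _ hKm]
    gcongr with w
    · exact enorm_le_eLpNorm_top_of_continuous hf _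
    · exact enorm_le_eLpNorm_top_of_continuous hg _
  have hp0 : p ≠ 0 := (zero_lt_one.trans_le hp).ne'
  have hpr : 1 ≤ p.toReal := by
    rw [← ENNReal.toReal_one]; exact ENNReal.toReal_mono hp_top hp
  have hpr0 : 0 < p.toReal := by linarith
  have : ENNReal.HolderTriple q₁ q₂ p := ⟨hpq.symm⟩
  have key := lintegral_rpow_lintegral_mul_le (μ := μ) (ν := (volume : Measure (Rd d)))
    (k := fun w => ‖K w‖ₑ) (g := fun x w => ‖f (x + a w)‖ₑ * ‖g (x + b w)‖ₑ)
    (c := eLpNorm f q₁ volume * eLpNorm g q₂ volume) hKm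
    ((hf.enorm.measurable.comp (measurable_fst.add (ha.comp measurable_snd))).mul
      (hg.enorm.measurable.comp (measurable_fst.add (hb.comp measurable_snd)))) hpr ?_
  · rw [eLpNorm_eq_lintegral_rpow_enorm_toReal hp0 hp_top]
    calc _ ≤ (∫⁻ x, (∫⁻ w, ‖K w‖ₑ * (‖f (x + a w)‖ₑ * ‖g (x + b w)‖ₑ) ∂μ) ^ p.toReal)
          ^ (1 / p.toReal) := by
          gcongr with x
          exact hpt x
      _ ≤ _ := ENNReal.rpow_le_rpow key (by positivity)
      _ = _ := by
        rw [← ENNReal.rpow_mul, mul_one_div_cancel hpr0.ne', ENNReal.rpow_one]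
  · intro w
    have h := eLpNorm_le_eLpNorm_mul_eLpNorm_of_nnnorm (μ := (volume : Measure (Rd d)))
      (p := q₁) (q := q₂) (r := p)
      (f := fun x => ‖f (x + a w)‖) (g := fun x => ‖g (x + b w)‖)
      (by fun_prop) (by fun_prop)
      (fun s t => s * t) 1 (ae_of_all _ fun x => by simp)
    have h1 : eLpNorm (fun x => ‖f (x + a w)‖) q₁ volume = eLpNorm f q₁ volume := by
      rw [eLpNorm_norm]
      exact eLpNorm_comp_measurePreserving hf.aestronglyMeasurable
        (measurePreserving_add_right volume (a w))
    have h2 : eLpNorm (fun x => ‖g (x + b w)‖) q₂ volume = eLpNorm g q₂ volume := by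
      rw [eLpNorm_norm]
      exact eLpNorm_comp_measurePreserving hg.aestronglyMeasurable
        (measurePreserving_add_right volume (b w))
    rw [h1, h2, eLpNorm_eq_lintegral_rpow_enorm_toReal hp0 hp_top] at h
    have h' := ENNReal.rpow_le_rpow h hpr0.le
    rw [← ENNReal.rpow_mul, one_div_mul_cancel hpr0.ne', ENNReal.rpow_one] at h'
    simpa [enorm_mul] using h'

/-! ### Fourier inversion for the bilinear operator -/

open scoped FourierTransform

theorem hat_eq_fourier (f : Rd d → F₁) (ξ : Rd d) : hat f ξ = 𝓕 f ((2 * Real.pi)⁻¹ • ξ) := by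
  rw [hat, Real.fourier_eq']
  congr 1 with x
  congr 2
  rw [inner_smul_right]
  push_cast
  field_simp

theorem continuous_hat (f : 𝓢(Rd d, F₁)) : Continuous (hat f) := by
  have : hat f = fun ξ => 𝓕 f ((2 * Real.pi)⁻¹ • ξ) := by
    ext ξ; rw [hat_eq_fourier, fourier_coe]
  rw [this]
  fun_prop

theorem integrable_hat (f : 𝓢(Rd d, F₁)) : Integrable (hat f) := by
  have : hat f = fun ξ => 𝓕 f ((2 * Real.pi)⁻¹ • ξ) := by
    ext ξ; rw [hat_eq_fourier, fourier_coe]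
  rw [this]
  exact ((𝓕 f).integrable (μ := volume)).comp_smul (by positivity)

theorem integrable_exp_smul_hat (f : 𝓢(Rd d, F₁)) (x : Rd d) :
    Integrable (fun ξ => Complex.exp (Complex.I * ((inner ℝ x ξ : ℝ) : ℂ)) • hat f ξ) := by
  have := continuous_hat f
  refine (integrable_hat f).norm.mono' (Continuous.aestronglyMeasurable (by fun_prop))
    (ae_of_all _ fun ξ => ?_)
  rw [norm_smul, mul_comm Complex.I, Complex.norm_exp_ofReal_mul_I, one_mul]

theorem integral_exp_smul_hat [CompleteSpace F₁] (f : 𝓢(Rd d, F₁)) (x : Rd d) :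
    ∫ ξ, Complex.exp (Complex.I * ((inner ℝ x ξ : ℝ) : ℂ)) • hat f ξ =
      ((2 * Real.pi) ^ d : ℝ) • f x := by
  have h : 𝓕⁻ (𝓕 f) x = f x := by rw [FourierPair.fourierInv_fourier_eq]
  rw [fourierInv_coe, Real.fourierInv_eq', fourier_coe] at h
  rw [← h]
  have := Measure.integral_comp_inv_smul (volume : Measure (Rd d))
    (fun v => Complex.exp (↑(2 * Real.pi * inner ℝ v x) * Complex.I) • 𝓕 (⇑f) v) (2 * Real.pi)
  rw [finrank_euclideanSpace_fin, abs_of_nonneg (by positivity)] at this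
  rw [← this]
  congr 1 with ξ
  rw [hat_eq_fourier]
  congr 2
  rw [inner_smul_left, real_inner_comm]
  simp only [map_inv₀, conj_trivial]
  push_cast
  field_simp

theorem integral_prod_bilin [CompleteSpace F₁] [CompleteSpace F₂] [CompleteSpace G]
    {X Y : Type*} [MeasurableSpace X] [MeasurableSpace Y] {μ : Measure X} {ν : Measure Y}
    [SFinite μ] [SFinite ν] (T : F₁ →L[ℂ] F₂ →L[ℂ] G) {u : X → F₁} {v : Y → F₂}
    (hu : Integrable u μ) (hv : Integrable v ν) :
    Integrable (fun z : X × Y => T (u z.1) (v z.2)) (μ.prod ν) ∧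
      ∫ z, T (u z.1) (v z.2) ∂(μ.prod ν) = T (∫ x, u x ∂μ) (∫ y, v y ∂ν) := by
  have hi : Integrable (fun z : X × Y => T (u z.1) (v z.2)) (μ.prod ν) := by
    refine ((hu.norm.mul_prod hv.norm).const_mul ‖T‖).mono' ?_ (ae_of_all _ fun z => ?_)
    · exact T.aestronglyMeasurable_comp₂ (hu.1.comp_fst) (hv.1.comp_snd)
    · simpa [mul_assoc] using T.le_opNorm₂ (u z.1) (v z.2)
  refine ⟨hi, ?_⟩
  rw [integral_prod _ hi]
  have : ∀ x, ∫ y, T (u x) (v y) ∂ν = T.flip (∫ y, v y ∂ν) (u x) := fun x => by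
    rw [ContinuousLinearMap.integral_comp_comm _ hv, ContinuousLinearMap.flip_apply]
  simp_rw [this]
  rw [ContinuousLinearMap.integral_comp_comm _ hu, ContinuousLinearMap.flip_apply]

/-- If the symbol is a superposition of the characters `e^{i(a(w)·ξ + b(w)·η)}` on the frequency
supports of `f` and `g`, then the operator is the same superposition of products of translates. -/
theorem bilinearOp_eq_integral [CompleteSpace H] [CompleteSpace F₁] [CompleteSpace F₂]
    [CompleteSpace G]
    {W : Type*} [MeasurableSpace W] [TopologicalSpace W]
    [OpensMeasurableSpace W] [SecondCountableTopology W] {μ : Measure W} [SFinite μ]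
    {K : W → H} (hK : Continuous K) {T : H →L[ℂ] F₁ →L[ℂ] F₂ →L[ℂ] G}
    (hT : ∀ h u v, ‖T h u v‖ ≤ ‖h‖ * ‖u‖ * ‖v‖) (hKi : Integrable K μ)
    {a b : W → Rd d} (ha : Continuous a) (hb : Continuous b)
    (m : Rd d × Rd d → H) (f : 𝓢(Rd d, F₁)) (g : 𝓢(Rd d, F₂))
    (hm : ∀ ξ η, hat f ξ ≠ 0 → hat g η ≠ 0 → m (ξ, η) =
      ∫ w, Complex.exp (Complex.I * ((inner ℝ (a w) ξ + inner ℝ (b w) η : ℝ) : ℂ)) • K w ∂μ)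
    (x : Rd d) :
    bilinearOp (fun z => T (m z)) f g x = ∫ w, T (K w) (f (x + a w)) (g (x + b w)) ∂μ := by
  -- the integrand on the space of pairs (frequencies, `w`)
  let Ψ : (Rd d × Rd d) → W → G := fun z w =>
    T (K w) (Complex.exp (Complex.I * ((inner ℝ (x + a w) z.1 : ℝ) : ℂ)) • hat f z.1)
      (Complex.exp (Complex.I * ((inner ℝ (x + b w) z.2 : ℝ) : ℂ)) • hat g z.2)
  have hexp : ∀ t : ℝ, ‖Complex.exp (Complex.I * (t : ℂ))‖ = 1 := fun t => by
    rw [mul_comm, Complex.norm_exp_ofReal_mul_I]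
  have hch := continuous_hat f
  have hcg := continuous_hat g
  have hΨ : Integrable (Function.uncurry Ψ) ((volume : Measure (Rd d × Rd d)).prod μ) := by
    have hfg : Integrable (fun z : Rd d × Rd d => ‖hat f z.1‖ * ‖hat g z.2‖) volume :=
      (integrable_hat f).norm.mul_prod (integrable_hat g).norm
    refine (hfg.mul_prod hKi.norm).mono' ?_ (ae_of_all _ fun z => ?_)
    · refine Continuous.aestronglyMeasurable ?_
      simp only [Ψ, Function.uncurry_def]
      fun_prop
    · refine (hT _ _ _).trans (le_of_eq ?_)
      rw [norm_smul, norm_smul, hexp, hexp]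
      ring
  have hL : ∀ z : Rd d × Rd d,
      Complex.exp (Complex.I * ((inner ℝ x (z.1 + z.2) : ℝ) : ℂ)) •
        T (m z) (hat f z.1) (hat g z.2) =
        ∫ w, Ψ z w ∂μ := by
    intro z
    by_cases h1 : hat f z.1 = 0
    · simp [Ψ, h1]
    by_cases h2 : hat g z.2 = 0
    · simp [Ψ, h2]
    have hint : Integrable (fun w => Complex.exp
        (Complex.I * ((inner ℝ (a w) z.1 + inner ℝ (b w) z.2 : ℝ) : ℂ)) • K w) μ := by
      refine hKi.norm.mono' (Continuous.aestronglyMeasurable (by fun_prop))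
        (ae_of_all _ fun w => ?_)
      rw [norm_smul, hexp, one_mul]
    have hz : m z = _ := hm z.1 z.2 h1 h2
    let Λ : H →L[ℂ] G :=
      (ContinuousLinearMap.apply ℂ G (hat g z.2)).comp
        ((ContinuousLinearMap.apply ℂ (F₂ →L[ℂ] G) (hat f z.1)).comp T)
    have hΛ : ∀ h, T h (hat f z.1) (hat g z.2) = Λ h := fun h => rfl
    rw [hz, hΛ, ← ContinuousLinearMap.integral_comp_comm _ hint, ← integral_smul]
    congr 1 with w
    simp only [Ψ, map_smul, _root_.smul_apply, hΛ, smul_smul, ← Complex.exp_add]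
    congr 2
    simp only [inner_add_left, inner_add_right]
    push_cast
    ring
  have hR : ∀ w, ∫ z, Ψ z w =
      (((2 * Real.pi) ^ (2 * d)) : ℝ) • T (K w) (f (x + a w)) (g (x + b w)) := by
    intro w
    have := (integral_prod_bilin (T (K w)) (integrable_exp_smul_hat f (x + a w))
      (integrable_exp_smul_hat g (x + b w))).2
    rw [integral_exp_smul_hat, integral_exp_smul_hat] at this
    rw [Measure.volume_eq_prod, this]
    simp only [← Complex.coe_smul, map_smul, _root_.smul_apply, smul_smul]
    congr 1
    push_cast
    ring
  rw [bilinearOp]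
  simp_rw [hL]
  rw [integral_integral_swap hΨ]
  simp_rw [hR]
  rw [integral_smul, smul_smul, inv_mul_cancel₀ (by positivity), one_smul]

end Bilinear

/-! ### Kernels of smooth compactly supported symbols -/

section Kernel

open scoped FourierTransform

theorem exists_bound_iteratedFDeriv {W : Type*} [NormedAddCommGroup W] [NormedSpace ℝ W]
    {χ : W → ℝ} (hχ : ContDiff ℝ ∞ χ) (hc : HasCompactSupport χ) (N : ℕ) :
    ∃ C : ℝ, 0 ≤ C ∧ ∀ n ≤ N, ∀ w, ‖iteratedFDeriv ℝ n χ w‖ ≤ C := by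
  have h : ∀ n : ℕ, ∃ C, ∀ w, ‖iteratedFDeriv ℝ n χ w‖ ≤ C := fun n =>
    (hχ.continuous_iteratedFDeriv (mod_cast le_top)).bounded_above_of_compact_support
      (hc.iteratedFDeriv n)
  choose c hc' using h
  refine ⟨∑ n ∈ Finset.range (N + 1), |c n|, by positivity, fun n hn w => ?_⟩
  exact (hc' n w).trans ((le_abs_self _).trans (Finset.single_le_sum (f := fun n => |c n|)
    (fun _ _ => abs_nonneg _) (Finset.mem_range.2 (by omega))))

theorem contDiff_cutoff_smul {W E : Type*} [NormedAddCommGroup W] [NormedSpace ℝ W]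
    [NormedAddCommGroup E] [NormedSpace ℝ E] {χ : W → ℝ} (hχ : ContDiff ℝ ∞ χ)
    {O : Set W} (hO : IsOpen O) (hχO : tsupport χ ⊆ O) {M : W → E} (hM : ContDiffOn ℝ ∞ M O) :
    ContDiff ℝ ∞ fun w => χ w • M w := by
  rw [contDiff_iff_contDiffAt]
  intro w
  by_cases hw : w ∈ tsupport χ
  · exact hχ.contDiffAt.smul (hM.contDiffAt (hO.mem_nhds (hχO hw)))
  · have : (fun w => χ w • M w) =ᶠ[nhds w] fun _ => 0 := by
      filter_upwards [(isClosed_tsupport χ).isOpen_compl.mem_nhds hw] with y hy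
      rw [image_eq_zero_of_notMem_tsupport hy, zero_smul]
    exact contDiffAt_const.congr_of_eventuallyEq this

theorem norm_iteratedFDeriv_cutoff_smul_le {W E : Type*} [NormedAddCommGroup W] [NormedSpace ℝ W]
    [NormedAddCommGroup E] [NormedSpace ℝ E] {χ : W → ℝ} (hχ : ContDiff ℝ ∞ χ)
    {O : Set W} (hO : IsOpen O) (hχO : tsupport χ ⊆ O) {M : W → E} (hM : ContDiffOn ℝ ∞ M O)
    {N : ℕ} {C Λ : ℝ} (hC : 0 ≤ C) (hΛ : 0 ≤ Λ) (hχC : ∀ n ≤ N, ∀ w, ‖iteratedFDeriv ℝ n χ w‖ ≤ C)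
    (hMΛ : ∀ n ≤ N, ∀ w ∈ tsupport χ, ‖iteratedFDeriv ℝ n M w‖ ≤ Λ) {n : ℕ} (hn : n ≤ N) (w : W) :
    ‖iteratedFDeriv ℝ n (fun w => χ w • M w) w‖ ≤ 2 ^ N * C * Λ := by
  by_cases hw : w ∈ tsupport χ
  · have hwO := hχO hw
    have h := norm_iteratedFDerivWithin_smul_le (𝕜 := ℝ) (N := ∞) hχ.contDiffOn hM
      hO.uniqueDiffOn hwO
      (n := n) (mod_cast le_top)
    rw [iteratedFDerivWithin_of_isOpen n hO hwO] at h
    simp only [iteratedFDerivWithin_of_isOpen _ hO hwO] at h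
    refine h.trans ?_
    calc _ ≤ ∑ i ∈ Finset.range (n + 1), (n.choose i : ℝ) * C * Λ := by
          refine Finset.sum_le_sum fun i hi => ?_
          have := Finset.mem_range.1 hi
          gcongr
          · exact hχC i (by omega) w
          · exact hMΛ (n - i) (by omega) w hw
      _ = 2 ^ n * C * Λ := by
          rw [← Finset.sum_mul, ← Finset.sum_mul]
          congr 2
          exact_mod_cast Nat.sum_range_choose n
      _ ≤ _ := by gcongr; norm_num
  · have : (fun w => χ w • M w) =ᶠ[nhds w] fun _ => 0 := by
      filter_upwards [(isClosed_tsupport χ).isOpen_compl.mem_nhds hw] with y hy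
      rw [image_eq_zero_of_notMem_tsupport hy, zero_smul]
    rw [this.iteratedFDeriv ℝ n |>.eq_of_nhds]
    have h0 : iteratedFDeriv ℝ n (fun _ : W => (0 : E)) = 0 := iteratedFDeriv_fun_zero
    rw [h0]
    simp only [Pi.zero_apply, norm_zero]
    positivity

variable {W : Type*} [NormedAddCommGroup W] [InnerProductSpace ℝ W] [FiniteDimensional ℝ W]
  [MeasurableSpace W] [BorelSpace W]

/-- A localized symbol whose derivatives up to order `dim W + 1` are at most `Λ` is the Fourier
transform of a kernel with `L¹` norm `O(Λ)`. The constant depends on the cutoff only, and not on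
the space in which the symbol takes its values. -/
theorem exists_kernel {χ : W → ℝ} (hχ : ContDiff ℝ ∞ χ) (hc : HasCompactSupport χ) :
    ∃ C : ℝ, 0 ≤ C ∧ ∀ (E : Type*) [NormedAddCommGroup E] [NormedSpace ℂ E] [CompleteSpace E]
      (M : W → E) (O : Set W) (Λ : ℝ), IsOpen O → tsupport χ ⊆ O → ContDiffOn ℝ ∞ M O → 0 ≤ Λ →
      (∀ n ≤ Module.finrank ℝ W + 1, ∀ w ∈ tsupport χ, ‖iteratedFDeriv ℝ n M w‖ ≤ Λ) →
      ∃ K : W → E, Continuous K ∧ Integrable K ∧ ∫⁻ w, ‖K w‖ₑ ≤ ENNReal.ofReal (C * Λ) ∧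
        ∀ w, χ w = 1 →
          M w = ∫ v, Complex.exp (Complex.I * ((2 * Real.pi * inner ℝ v w : ℝ) : ℂ)) • K v := by
  set N := Module.finrank ℝ W + 1 with hN
  obtain ⟨c, hc0, hcb⟩ := exists_bound_iteratedFDeriv hχ hc N
  set V : ℝ := volume.real (tsupport χ) with hV
  set J : ℝ := ∫ w : W, (1 + ‖w‖) ^ (-(N : ℝ)) with hJ
  have hJi : Integrable (fun w : W => (1 + ‖w‖) ^ (-(N : ℝ))) :=
    integrable_one_add_norm (by rw [hN]; push_cast; linarith)
  -- bounds `‖w‖ ^ n * ‖K w‖` for `n ≤ N`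
  set D : ℝ := 2 ^ N * ((N + 1 : ℕ) * (2 ^ N * c * V)) with hD
  have hD0 : 0 ≤ D := by positivity
  have hJ0 : 0 ≤ J := integral_nonneg fun w => by positivity
  refine ⟨2 ^ (N - 1) * (D + D) * J, by positivity, ?_⟩
  intro E _ _ _ M O Λ hO hχO hM hΛ hMΛ
  have hsm := contDiff_cutoff_smul hχ hO hχO hM
  have hcs : HasCompactSupport fun w => χ w • M w := hc.smul_right
  have hts : tsupport (fun w => χ w • M w) ⊆ tsupport χ := tsupport_smul_subset_left _ _
  set Φ : 𝓢(W, E) := hcs.toSchwartzMap hsm with hΦ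
  have hΦc : (Φ : W → E) = fun w => χ w • M w := rfl
  have hder : ∀ n ≤ N, ∫ v, ‖iteratedFDeriv ℝ n Φ v‖ ≤ 2 ^ N * c * V * Λ := by
    intro n hn
    have hb := norm_iteratedFDeriv_cutoff_smul_le hχ hO hχO hM hc0 hΛ hcb hMΛ hn
    rw [hΦc]
    have hsupp : ∀ v ∉ tsupport χ, ‖iteratedFDeriv ℝ n (fun w => χ w • M w) v‖ = 0 := by
      intro v hv
      rw [norm_eq_zero]
      by_contra h0
      exact hv (hts (support_iteratedFDeriv_subset n h0))
    rw [← setIntegral_eq_integral_of_forall_compl_eq_zero hsupp]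
    have := norm_setIntegral_le_of_norm_le_const (μ := (volume : Measure W)) (s := tsupport χ)
      (f := fun v => ‖iteratedFDeriv ℝ n (fun w => χ w • M w) v‖) (C := 2 ^ N * c * Λ)
      hc.isCompact.measure_lt_top (fun v _ => by rw [norm_norm]; exact hb v)
    refine (le_abs_self _).trans (this.trans (le_of_eq ?_))
    rw [hV]; ring
  have hpow : ∀ n ≤ N, ∀ w, ‖w‖ ^ n * ‖(𝓕 Φ) w‖ ≤ D * Λ := by
    intro n hn w
    have h := Real.pow_mul_norm_iteratedFDeriv_fourier_le (f := (Φ : W → E)) (K := 0) (N := ⊤)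
      Φ.smooth' (fun k n _ _ => Φ.integrable_pow_mul_iteratedFDeriv volume k n) (k := 0) (n := n)
      (by simp) (mod_cast le_top) w
    rw [norm_iteratedFDeriv_zero] at h
    refine h.trans ?_
    simp only [pow_zero, one_mul, CharP.cast_eq_zero, mul_zero, zero_add, Finset.range_one,
      Finset.sum_product, Finset.sum_singleton]
    calc (2 : ℝ) ^ n * ∑ y ∈ Finset.range (n + 1), ∫ v, ‖iteratedFDeriv ℝ y Φ v‖
        ≤ 2 ^ n * ∑ y ∈ Finset.range (n + 1), 2 ^ N * c * V * Λ := by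
          gcongr with y hy
          exact hder y (by have := Finset.mem_range.1 hy; omega)
      _ = 2 ^ n * ((n + 1 : ℕ) * (2 ^ N * c * V * Λ)) := by
          rw [Finset.sum_const, Finset.card_range, nsmul_eq_mul]
      _ ≤ 2 ^ N * ((N + 1 : ℕ) * (2 ^ N * c * V * Λ)) := by
          gcongr
          norm_num
      _ = D * Λ := by rw [hD]; ring
  have hdecay : ∀ w, ‖(𝓕 Φ) w‖ ≤ 2 ^ (N - 1) * (D + D) * Λ * (1 + ‖w‖) ^ (-(N : ℝ)) := by
    intro w
    have h1 : 0 < 1 + ‖w‖ := by positivity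
    rw [Real.rpow_neg h1.le, Real.rpow_natCast, ← div_eq_mul_inv, le_div_iff₀ (by positivity)]
    have h2 := add_pow_le (zero_le_one (α := ℝ)) (norm_nonneg w) N
    have h3 := hpow 0 (Nat.zero_le _) w
    have h4 := hpow N le_rfl w
    rw [pow_zero, one_mul] at h3
    calc ‖(𝓕 Φ) w‖ * (1 + ‖w‖) ^ N ≤ ‖(𝓕 Φ) w‖ * (2 ^ (N - 1) * (1 ^ N + ‖w‖ ^ N)) := by gcongr
      _ = 2 ^ (N - 1) * (‖(𝓕 Φ) w‖ + ‖w‖ ^ N * ‖(𝓕 Φ) w‖) := by ring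
      _ ≤ 2 ^ (N - 1) * (D * Λ + D * Λ) := by gcongr
      _ = _ := by ring
  refine ⟨fun w => (𝓕 Φ) w, (𝓕 Φ).continuous, (𝓕 Φ).integrable, ?_, ?_⟩
  · rw [← ofReal_integral_norm_eq_lintegral_enorm (𝓕 Φ).integrable]
    refine ENNReal.ofReal_le_ofReal ?_
    calc ∫ w, ‖(𝓕 Φ) w‖ ≤ ∫ w, 2 ^ (N - 1) * (D + D) * Λ * (1 + ‖w‖) ^ (-(N : ℝ)) :=
          integral_mono (𝓕 Φ).integrable.norm (hJi.const_mul _) hdecay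
      _ = _ := by rw [integral_const_mul]; ring
  · intro w hw
    have h : 𝓕⁻ (𝓕 Φ) w = Φ w := by rw [FourierPair.fourierInv_fourier_eq]
    rw [fourierInv_coe, Real.fourierInv_eq'] at h
    have h5 : Φ w = M w := by rw [hΦc]; simp [hw]
    rw [← h5, ← h]
    congr 1 with v
    rw [mul_comm Complex.I]

end Kernel

/-! ### Iterated derivatives along vector fields -/

section LieDerivative

variable {E H ι : Type*} [NormedAddCommGroup E] [NormedSpace ℝ E]
  [NormedAddCommGroup H] [NormedSpace ℝ H]

/-- The derivative of a function `u` along a vector field `X`. -/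
def lieDeriv (X : E → E) (u : E → H) : E → H := fun z => fderiv ℝ u z (X z)

/-- The iterated derivative of `u` along the vector fields named by a word; the first letter is
applied last. -/
def lieWord (X : ι → E → E) (l : List ι) (u : E → H) : E → H :=
  l.foldr (fun i g => lieDeriv (X i) g) u

theorem lieWord_append (X : ι → E → E) (l l' : List ι) (u : E → H) :
    lieWord X (l ++ l') u = lieWord X l (lieWord X l' u) := by
  simp [lieWord, List.foldr_append]

theorem lieWord_replicate (X : ι → E → E) (i : ι) (n : ℕ) (u : E → H) :
    lieWord X (List.replicate n i) u = (lieDeriv (X i))^[n] u := by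
  induction n with
  | zero => rfl
  | succ n ih =>
    rw [Function.iterate_succ_apply', ← ih]
    rfl

theorem lieWord_flatMap_replicate {κ : Type*} (X : ι → E → E) (e : κ → ι) (α : κ → ℕ) (l : List κ)
    (u : E → H) :
    lieWord X (l.flatMap fun k => List.replicate (α k) (e k)) u =
      l.foldr (fun k g => (lieDeriv (X (e k)))^[α k] g) u := by
  induction l with
  | nil => rfl
  | cons k l ih => rw [List.flatMap_cons, lieWord_append, ih, lieWord_replicate]; rfl

variable {Ω : Set E}

theorem lieDeriv_congr (hΩ : IsOpen Ω) (X : E → E) {u v : E → H} (h : Set.EqOn u v Ω) :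
    Set.EqOn (lieDeriv X u) (lieDeriv X v) Ω := fun z hz => by
  have : u =ᶠ[nhds z] v := h.eventuallyEq_of_mem (hΩ.mem_nhds hz)
  rw [lieDeriv, lieDeriv, this.fderiv_eq]

theorem lieWord_congr (hΩ : IsOpen Ω) (X : ι → E → E) {u v : E → H} (h : Set.EqOn u v Ω)
    (l : List ι) : Set.EqOn (lieWord X l u) (lieWord X l v) Ω := by
  induction l with
  | nil => exact h
  | cons i l ih => exact lieDeriv_congr hΩ (X i) ih

theorem contDiffOn_lieDeriv (hΩ : IsOpen Ω) {X : E → E} (hX : ContDiff ℝ ∞ X) {u : E → H}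
    (hu : ContDiffOn ℝ ∞ u Ω) : ContDiffOn ℝ ∞ (lieDeriv X u) Ω :=
  (hu.fderiv_of_isOpen hΩ (by simp)).clm_apply hX.contDiffOn

theorem contDiffOn_lieWord (hΩ : IsOpen Ω) {X : ι → E → E} (hX : ∀ i, ContDiff ℝ ∞ (X i))
    {u : E → H} (hu : ContDiffOn ℝ ∞ u Ω) (l : List ι) : ContDiffOn ℝ ∞ (lieWord X l u) Ω := by
  induction l with
  | nil => exact hu
  | cons i l ih => exact contDiffOn_lieDeriv hΩ (hX i) ih

theorem lieWord_sub_smul (hΩ : IsOpen Ω) {X : ι → E → E} (hX : ∀ i, ContDiff ℝ ∞ (X i))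
    {u v : E → H} (hu : ContDiffOn ℝ ∞ u Ω) (hv : ContDiffOn ℝ ∞ v Ω) (c : ℝ) (l : List ι) :
    Set.EqOn (lieWord X l fun z => u z - c • v z)
      (fun z => lieWord X l u z - c • lieWord X l v z) Ω := by
  induction l with
  | nil => exact fun z _ => rfl
  | cons i l ih =>
    intro z hz
    refine (lieDeriv_congr hΩ (X i) ih hz).trans ?_
    have h1 := ((contDiffOn_lieWord hΩ hX hu l).contDiffAt (hΩ.mem_nhds hz)).differentiableAt
      (by simp)
    have h2 := ((contDiffOn_lieWord hΩ hX hv l).contDiffAt (hΩ.mem_nhds hz)).differentiableAt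
      (by simp)
    change fderiv ℝ (fun z => lieWord X l u z - c • lieWord X l v z) z (X i z) = _
    rw [(h1.hasFDerivAt.fun_sub (h2.hasFDerivAt.fun_const_smul c)).fderiv]
    rfl

theorem lieDeriv_comm (hΩ : IsOpen Ω) {X Y : E → E} (hX : ContDiff ℝ ∞ X) (hY : ContDiff ℝ ∞ Y)
    (hXY : ∀ z, fderiv ℝ X z (Y z) = fderiv ℝ Y z (X z)) {u : E → H} (hu : ContDiffOn ℝ ∞ u Ω) :
    Set.EqOn (lieDeriv X (lieDeriv Y u)) (lieDeriv Y (lieDeriv X u)) Ω := fun z hz => by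
  have h := VectorField.fderiv_apply_lieBracket (𝕜 := ℝ) (V := X) (W := Y)
    (hu.contDiffAt (hΩ.mem_nhds hz)) (by simpa using WithTop.coe_le_coe.2 (le_top : (2 : ℕ∞) ≤ ⊤))
    (hY.differentiable (by simp) z) (hX.differentiable (by simp) z)
  rw [VectorField.lieBracket, hXY, sub_self, map_zero] at h
  exact (sub_eq_zero.1 h.symm)

theorem lieWord_perm (hΩ : IsOpen Ω) {X : ι → E → E} (hX : ∀ i, ContDiff ℝ ∞ (X i))
    (hXX : ∀ i j z, fderiv ℝ (X i) z (X j z) = fderiv ℝ (X j) z (X i z))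
    {u : E → H} (hu : ContDiffOn ℝ ∞ u Ω) {l l' : List ι} (h : l.Perm l') :
    Set.EqOn (lieWord X l u) (lieWord X l' u) Ω := by
  induction h with
  | nil => exact fun z _ => rfl
  | cons i _ ih => exact lieDeriv_congr hΩ (X i) ih
  | swap i j l =>
    exact lieDeriv_comm hΩ (hX j) (hX i) (hXX j i) (contDiffOn_lieWord hΩ hX hu l)
  | trans _ _ h1 h2 => exact h1.trans h2

theorem differentiableAt_iteratedFDeriv (hΩ : IsOpen Ω) {u : E → H} (hu : ContDiffOn ℝ ∞ u Ω)
    (n : ℕ) {z : E} (hz : z ∈ Ω) : DifferentiableAt ℝ (iteratedFDeriv ℝ n u) z :=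
  (hu.contDiffAt (hΩ.mem_nhds hz)).differentiableAt_iteratedFDeriv
    (by exact_mod_cast ENat.natCast_lt_top n)

theorem lieWord_const (hΩ : IsOpen Ω) (b : ι → E) {u : E → H} (hu : ContDiffOn ℝ ∞ u Ω)
    (l : List ι) : Set.EqOn (lieWord (fun i _ => b i) l u)
      (fun z => iteratedFDeriv ℝ l.length u z fun k => b (l.get k)) Ω := by
  induction l with
  | nil => exact fun z _ => (iteratedFDeriv_zero_apply _).symm
  | cons i l ih =>
    intro z hz
    refine (lieDeriv_congr hΩ (fun _ => b i) ih hz).trans ?_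
    exact ((differentiableAt_iteratedFDeriv hΩ hu l.length hz).iteratedFDeriv_succ_apply_left'
      (m := fun k => b ((i :: l).get k))).symm

/-- The iterated derivative of `u` at `z` evaluated at the vectors `L_i z`, for linear maps `L_i`
named by a word. -/
def radialDeriv (L : ι → E →L[ℝ] E) (l : List ι) (u : E → H) : E → H :=
  fun z => iteratedFDeriv ℝ l.length u z fun k => L (l.get k) z

theorem lieDeriv_radialDeriv [DecidableEq ι] (hΩ : IsOpen Ω) {L : ι → E →L[ℝ] E}
    (hL : ∀ i j z, L i (L j z) = if i = j then L j z else 0) {u : E → H}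
    (hu : ContDiffOn ℝ ∞ u Ω) (i : ι) (l : List ι) {z : E} (hz : z ∈ Ω) :
    lieDeriv (fun z => L i z) (radialDeriv L l u) z =
      radialDeriv L (i :: l) u z + (l.count i : ℝ) • radialDeriv L l u z := by
  have h := (differentiableAt_iteratedFDeriv hΩ hu l.length hz).hasFDerivAt
    |>.continuousMultilinearMap_apply (g := fun k z => L (l.get k) z)
      (fun k => (L (l.get k)).hasFDerivAt)
  have h' : lieDeriv (fun z => L i z) (radialDeriv L l u) z = _ := congrArg (· (L i z)) h.fderiv
  rw [h']
  have hk : ∀ k : Fin l.length, iteratedFDeriv ℝ l.length u z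
      (Function.update (fun k => L (l.get k) z) k (L (l.get k) (L i z))) =
      if l.get k = i then radialDeriv L l u z else 0 := by
    intro k
    rw [hL]
    split_ifs with hki
    · rw [radialDeriv]
      congr 1
      conv_lhs => rw [← hki]
      exact Function.update_eq_self k fun k => L (l.get k) z
    · exact ContinuousMultilinearMap.map_coord_zero _ k (Function.update_self ..)
  simp only [_root_.add_apply, ContinuousLinearMap.comp_apply, _root_.sum_apply,
    ContinuousMultilinearMap.apply_apply, ContinuousMultilinearMap.toContinuousLinearMap_apply, hk]
  congr 1
  have hs : ∀ (x : H) (l : List ι), ∑ k : Fin l.length, (if l.get k = i then x else 0) =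
      (l.count i : ℝ) • x := by
    intro x l
    refine (Fin.sum_univ_fun_getElem l fun j => if j = i then x else 0).trans ?_
    induction l with
    | nil => simp
    | cons j l ih =>
      simp only [List.map_cons, List.sum_cons, ih, List.count_cons, beq_iff_eq]
      split_ifs <;> simp [add_smul, add_comm]
  exact hs _ l

end LieDerivative

/-! ### Derivative bounds for null forms -/

section Bounds

universe u

variable {d : ℕ}

/-- The set `{ξ ≠ 0, η ≠ 0}` on which a null form is smooth. -/
def regularSet (d : ℕ) : Set (Rd d × Rd d) := {z | z.1 ≠ 0 ∧ z.2 ≠ 0}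

theorem isOpen_regularSet : IsOpen (regularSet d) :=
  (isOpen_ne_fun continuous_fst continuous_const).inter
    (isOpen_ne_fun continuous_snd continuous_const)

/-- The standard basis of `ℝ^d × ℝ^d`. -/
def stdVec : Bool × Fin d → Rd d × Rd d :=
  fun j => if j.1 then (EuclideanSpace.single j.2 1, 0) else (0, EuclideanSpace.single j.2 1)

/-- The coordinates of a vector with respect to `stdVec`. -/
def stdCoord (v : Rd d × Rd d) : Bool × Fin d → ℝ := fun j =>
  if j.1 then v.1 j.2 else v.2 j.2

theorem sum_stdCoord_smul (v : Rd d × Rd d) : ∑ j, stdCoord v j • stdVec j = v := by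
  rw [Fintype.sum_prod_type, Fintype.sum_bool]
  have h : ∀ x : Rd d, ∑ i, x i • EuclideanSpace.single i (1 : ℝ) = x := fun x => by
    ext j
    simp [Pi.single_apply]
  ext1
  · simp [stdCoord, stdVec, Prod.fst_sum, h]
  · simp [stdCoord, stdVec, Prod.snd_sum, h]

theorem multiLeft_multiRight_eq_lieWord {H : Type*} [NormedAddCommGroup H] [NormedSpace ℝ H]
    (α β : Fin d → ℕ) (m : Rd d × Rd d → H) :
    multiLeft α (multiRight β m) = lieWord (fun j _ => stdVec j)
      (((List.finRange d).flatMap fun i => List.replicate (α i) (true, i)) ++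
        ((List.finRange d).flatMap fun i => List.replicate (β i) (false, i))) m := by
  rw [lieWord_append, lieWord_flatMap_replicate, lieWord_flatMap_replicate]
  rfl

theorem perm_sorted_word (l : List (Bool × Fin d)) :
    l.Perm (((List.finRange d).flatMap fun i =>
        List.replicate (l.count (true, i)) (true, i)) ++
      ((List.finRange d).flatMap fun i => List.replicate (l.count (false, i)) (false, i))) := by
  rw [List.perm_iff_count]
  have h : ∀ (c : Fin d → ℕ) (j : Fin d),
      ((List.finRange d).map fun i => if i = j then c i else 0).sum = c j := by
    intro c j
    rw [← List.ofFn_eq_map, List.sum_ofFn]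
    simp
  rintro ⟨_ | _, j⟩
  · simp [List.count_append, List.count_flatMap, Function.comp_def, List.count_replicate, h]
  · simp [List.count_append, List.count_flatMap, Function.comp_def, List.count_replicate, h]

/-- The size of a vector `v` at the point `z`, relative to the sizes of the components of `z`. -/
def relSize (z v : Rd d × Rd d) : ℝ := ‖z.1‖⁻¹ * ‖v.1‖ + ‖z.2‖⁻¹ * ‖v.2‖

theorem relSize_nonneg (z v : Rd d × Rd d) : 0 ≤ relSize z v := by
  unfold relSize; positivity

/-- The weight `|ξ|⁻¹` or `|η|⁻¹` attached to a coordinate direction at `z = (ξ, η)`. -/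
def dirWeight (z : Rd d × Rd d) : Bool × Fin d → ℝ :=
  fun j => if j.1 then ‖z.1‖⁻¹ else ‖z.2‖⁻¹

theorem abs_stdCoord_mul_dirWeight_le (z v : Rd d × Rd d) (j : Bool × Fin d) :
    |stdCoord v j| * dirWeight z j ≤ relSize z v := by
  rcases j with ⟨_ | _, j⟩
  · have := PiLp.norm_apply_le v.2 j
    rw [Real.norm_eq_abs] at this
    simp only [stdCoord, dirWeight, relSize, Bool.false_eq_true, if_false]
    rw [mul_comm]
    have h2 : 0 ≤ ‖z.1‖⁻¹ * ‖v.1‖ := by positivity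
    have : ‖z.2‖⁻¹ * |v.2 j| ≤ ‖z.2‖⁻¹ * ‖v.2‖ := by gcongr
    linarith
  · have := PiLp.norm_apply_le v.1 j
    rw [Real.norm_eq_abs] at this
    simp only [stdCoord, dirWeight, relSize, if_true]
    rw [mul_comm]
    have h2 : 0 ≤ ‖z.2‖⁻¹ * ‖v.2‖ := by positivity
    have : ‖z.1‖⁻¹ * |v.1 j| ≤ ‖z.1‖⁻¹ * ‖v.1‖ := by gcongr
    linarith

variable {H : Type u} [NormedAddCommGroup H] [NormedSpace ℝ H]
  {A : ℕ → ℕ → ℝ} {B : (Fin d → ℕ) → (Fin d → ℕ) → ℝ}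

theorem IsAbstractNullForm.contDiffOn {m : Rd d × Rd d → H} (hm : IsAbstractNullForm A B m) :
    ContDiffOn ℝ ∞ m (regularSet d) := hm.smooth

theorem IsAbstractNullForm.norm_iteratedFDeriv_stdVec_le {m : Rd d × Rd d → H}
    (hm : IsAbstractNullForm A B m) (l : List (Bool × Fin d)) {z : Rd d × Rd d}
    (hz : z ∈ regularSet d) :
    ‖iteratedFDeriv ℝ l.length m z fun k => stdVec (l.get k)‖ ≤
      B (fun i => l.count (true, i)) (fun i => l.count (false, i)) *
        ∏ k : Fin l.length, dirWeight z (l.get k) := by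
  have h1 := lieWord_const isOpen_regularSet stdVec hm.contDiffOn l hz
  have h2 := lieWord_perm isOpen_regularSet (X := fun j (_ : Rd d × Rd d) => stdVec j)
    (fun _ => contDiff_const) (fun i j z => by simp) hm.contDiffOn (perm_sorted_word l) hz
  rw [← multiLeft_multiRight_eq_lieWord] at h2
  have h12 := h1.symm.trans h2
  dsimp only at h12
  rw [h12]
  refine (hm.deriv_bound _ _ z.1 z.2 hz.1 hz.2).trans (le_of_eq ?_)
  rw [mul_assoc]
  congr 1
  have h3 : ∏ k : Fin l.length, dirWeight z (l.get k) = (l.map (dirWeight z)).prod :=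
    Fin.prod_univ_fun_getElem l _
  have h4 : (l.map (dirWeight z)).prod = ∏ j, dirWeight z j ^ l.count j := by
    clear h1 h2 h12 h3
    induction l with
    | nil => simp
    | cons i l ih =>
      have hi : ∀ j, dirWeight z j ^ (i :: l).count j =
          (if i = j then dirWeight z j else 1) * dirWeight z j ^ l.count j := by
        intro j
        rw [List.count_cons]
        by_cases h : i = j <;> simp [h, pow_succ']
      simp_rw [hi]
      rw [Finset.prod_mul_distrib, Finset.prod_ite_eq, if_pos (Finset.mem_univ i), List.map_cons,
        List.prod_cons, ih]
  rw [h3, h4, Fintype.prod_prod_type, Fintype.prod_bool]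
  simp [dirWeight, Finset.prod_pow_eq_pow_sum]

/-- All derivatives of a null form, in arbitrary directions, are controlled by the bounds on the
partial derivatives. -/
theorem exists_norm_iteratedFDeriv_le (B : (Fin d → ℕ) → (Fin d → ℕ) → ℝ) (n : ℕ) :
    ∃ C : ℝ, 0 ≤ C ∧ ∀ (H : Type u) [NormedAddCommGroup H] [NormedSpace ℝ H] (A : ℕ → ℕ → ℝ)
      (m : Rd d × Rd d → H), IsAbstractNullForm A B m → ∀ z ∈ regularSet d,
      ∀ v : Fin n → Rd d × Rd d, ‖iteratedFDeriv ℝ n m z v‖ ≤ C * ∏ i, relSize z (v i) := by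
  let b : (Fin n → Bool × Fin d) → ℝ := fun σ =>
    |B (fun i => (List.ofFn σ).count (true, i)) (fun i => (List.ofFn σ).count (false, i))|
  refine ⟨∑ σ, b σ, by positivity, fun H _ _ A m hm z hz v => ?_⟩
  have hv : v = fun i => ∑ j, stdCoord (v i) j • stdVec j := by
    ext1 i; rw [sum_stdCoord_smul]
  conv_lhs => rw [hv]
  rw [ContinuousMultilinearMap.map_sum, Finset.sum_mul]
  refine (norm_sum_le _ _).trans (Finset.sum_le_sum fun σ _ => ?_)
  rw [ContinuousMultilinearMap.map_smul_univ, norm_smul, norm_prod]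
  have h := hm.norm_iteratedFDeriv_stdVec_le (List.ofFn σ) hz
  have h' : ‖iteratedFDeriv ℝ n m z fun k => stdVec (σ k)‖ ≤ b σ * ∏ k, dirWeight z (σ k) := by
    have hw : 0 ≤ ∏ k, dirWeight z (σ k) := Finset.prod_nonneg fun k _ => by
      rcases σ k with ⟨_ | _, j⟩ <;> simp [dirWeight]
    refine le_trans ?_ (mul_le_mul_of_nonneg_right (le_abs_self _) hw)
    have hl : (List.ofFn σ).length = n := List.length_ofFn
    have hσ : ∀ k, σ k = (List.ofFn σ).get (Fin.cast hl.symm k) := fun k => by simp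
    generalize List.ofFn σ = l at hl hσ h
    subst hl
    simpa [hσ] using h
  calc _ ≤ (∏ i, ‖stdCoord (v i) (σ i)‖) * (b σ * ∏ k, dirWeight z (σ k)) := by gcongr
    _ = b σ * ∏ i, (|stdCoord (v i) (σ i)| * dirWeight z (σ i)) := by
        rw [Finset.prod_mul_distrib]; simp only [Real.norm_eq_abs]; ring
    _ ≤ _ := by
        gcongr with i
        · intro i _
          refine mul_nonneg (abs_nonneg _) ?_
          rcases σ i with ⟨_ | _, j⟩ <;> simp [dirWeight]
        · exact abs_stdCoord_mul_dirWeight_le z (v i) (σ i)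

/-- The two projections of `ℝ^d × ℝ^d`, as vector fields: `S_ξ` for `true`, `S_η` for `false`. -/
def radialField (e : Bool) : (Rd d × Rd d) →L[ℝ] (Rd d × Rd d) :=
  if e then (ContinuousLinearMap.inl ℝ _ _).comp (ContinuousLinearMap.fst ℝ _ _)
  else (ContinuousLinearMap.inr ℝ _ _).comp (ContinuousLinearMap.snd ℝ _ _)

theorem radialField_true (z : Rd d × Rd d) : radialField true z = (z.1, 0) := rfl

theorem radialField_false (z : Rd d × Rd d) : radialField false z = (0, z.2) := rfl

theorem radialField_comp (i j : Bool) (z : Rd d × Rd d) :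
    radialField i (radialField j z) = if i = j then radialField j z else 0 := by
  cases i <;> cases j <;> simp [radialField_true, radialField_false]

/-- The hypotheses on `S_ξ^{n₁} S_η^{n₂} m` give bounds for all words in `S_ξ` and `S_η`, since
these fields commute. -/
theorem IsAbstractNullForm.norm_lieWord_le {m : Rd d × Rd d → H}
    (hm : IsAbstractNullForm A B m) (l : List Bool) {z : Rd d × Rd d} (hz : z ∈ regularSet d) :
    ‖lieWord (fun e z => radialField e z) l m z‖ ≤
      A (l.count true) (l.count false) * InnerProductGeometry.angle z.1 z.2 := by
  have hp : l.Perm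
      (List.replicate (l.count true) true ++ List.replicate (l.count false) false) := by
    rw [List.perm_iff_count]
    rintro (_ | _) <;> simp [List.count_replicate]
  have h := lieWord_perm isOpen_regularSet
    (X := fun e (z : Rd d × Rd d) => radialField e z) (fun e => (radialField e).contDiff)
    (fun i j z => by
      rw [(radialField i).hasFDerivAt.fderiv, (radialField j).hasFDerivAt.fderiv,
        radialField_comp, radialField_comp]
      by_cases hij : i = j
      · subst hij; rfl
      · rw [if_neg hij, if_neg (Ne.symm hij)]) hm.contDiffOn hp hz
  rw [h, lieWord_append, lieWord_replicate, lieWord_replicate]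
  exact hm.angle_bound _ _ z.1 z.2 hz.1 hz.2

/-- Every iterated derivative of a null form in the directions `(ξ, 0)` and `(0, η)` at the point
`(ξ, η)` is `O(∠(ξ, η))`: it is a polynomial in `S_ξ` and `S_η` applied to `m`. The bounds for
`lieWord` make the induction work. -/
theorem exists_norm_lieWord_radialDeriv_le (A : ℕ → ℕ → ℝ) (l : List Bool) :
    ∃ C : List Bool → ℝ, ∀ (H : Type u) [NormedAddCommGroup H] [NormedSpace ℝ H]
      (B : (Fin d → ℕ) → (Fin d → ℕ) → ℝ) (m : Rd d × Rd d → H), IsAbstractNullForm A B m →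
      ContDiffOn ℝ ∞ (radialDeriv radialField l m) (regularSet d) ∧
      ∀ s, ∀ z ∈ regularSet d,
        ‖lieWord (fun e z => radialField e z) s (radialDeriv radialField l m) z‖ ≤
          C s * InnerProductGeometry.angle z.1 z.2 := by
  induction l with
  | nil =>
    refine ⟨fun s => A (s.count true) (s.count false), fun H _ _ B m hm => ?_⟩
    have h0 : radialDeriv radialField [] m = m := by
      ext z; exact iteratedFDeriv_zero_apply _
    rw [h0]
    exact ⟨hm.contDiffOn, fun s z hz => hm.norm_lieWord_le s hz⟩
  | cons e l ih =>
    obtain ⟨C, hC⟩ := ih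
    refine ⟨fun s => C (s ++ [e]) + (l.count e : ℝ) * C s, fun H _ _ B m hm => ?_⟩
    obtain ⟨hsm, hb⟩ := hC H B m hm
    have hf : ∀ e : Bool, ContDiff ℝ ∞ fun z : Rd d × Rd d => radialField e z :=
      fun e => (radialField e).contDiff
    have hsm' := contDiffOn_lieDeriv isOpen_regularSet (hf e) hsm
    have heq : Set.EqOn (radialDeriv radialField (e :: l) m)
        (fun z => lieDeriv (fun z => radialField e z) (radialDeriv radialField l m) z -
          (l.count e : ℝ) • radialDeriv radialField l m z) (regularSet d) := fun z hz => by
      dsimp only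
      rw [lieDeriv_radialDeriv isOpen_regularSet radialField_comp hm.contDiffOn e l hz,
        add_sub_cancel_right]
    refine ⟨(hsm'.sub (hsm.const_smul (l.count e : ℝ))).congr heq, fun s z hz => ?_⟩
    rw [lieWord_congr isOpen_regularSet _ heq s hz,
      lieWord_sub_smul isOpen_regularSet hf hsm' hsm _ s hz]
    dsimp only
    have h1 := hb (s ++ [e]) z hz
    rw [lieWord_append] at h1
    have h2 := hb s z hz
    refine (norm_sub_le _ _).trans ?_
    rw [norm_smul, Real.norm_natCast, add_mul, mul_assoc]
    gcongr
    exact h1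

theorem exists_norm_iteratedFDeriv_radial_le (A : ℕ → ℕ → ℝ) (n : ℕ) (ε : Fin n → Bool) :
    ∃ C : ℝ, 0 ≤ C ∧ ∀ (H : Type u) [NormedAddCommGroup H] [NormedSpace ℝ H]
      (B : (Fin d → ℕ) → (Fin d → ℕ) → ℝ) (m : Rd d × Rd d → H), IsAbstractNullForm A B m →
      ∀ z ∈ regularSet d, ‖iteratedFDeriv ℝ n m z fun i => radialField (ε i) z‖ ≤
        C * InnerProductGeometry.angle z.1 z.2 := by
  obtain ⟨C, hC⟩ := exists_norm_lieWord_radialDeriv_le.{u} (d := d) A (List.ofFn ε)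
  refine ⟨|C []|, abs_nonneg _, fun H _ _ B m hm z hz => ?_⟩
  have h : ‖radialDeriv radialField (List.ofFn ε) m z‖ ≤ _ := (hC H B m hm).2 [] z hz
  refine le_trans ?_ (mul_le_mul_of_nonneg_right (le_abs_self _)
    (InnerProductGeometry.angle_nonneg _ _))
  clear hC
  rw [radialDeriv] at h
  have hl : (List.ofFn ε).length = n := List.length_ofFn
  have hσ : ∀ k, ε k = (List.ofFn ε).get (Fin.cast hl.symm k) := fun k => by simp
  generalize List.ofFn ε = l at hl hσ h
  subst hl
  simpa [hσ] using h

/-- The decisive derivative bound. If the vectors `v_i` are, up to errors of relative size `O(θ)`,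
combinations of the radial directions `(ξ, 0)` and `(0, η)`, and if `∠(ξ, η) = O(θ)`, then the
derivative of a null form in the directions `v_i` is `O(θ)`: the purely radial contribution is
small by the angular bounds, and all others contain a short vector. -/
theorem exists_norm_iteratedFDeriv_le_mul (A : ℕ → ℕ → ℝ) (B : (Fin d → ℕ) → (Fin d → ℕ) → ℝ)
    (κ : ℝ) (hκ : 1 ≤ κ) (n : ℕ) :
    ∃ C : ℝ, 0 ≤ C ∧ ∀ (H : Type u) [NormedAddCommGroup H] [NormedSpace ℝ H]
      (m : Rd d × Rd d → H), IsAbstractNullForm A B m → ∀ z ∈ regularSet d, ∀ θ : ℝ, 0 ≤ θ →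
      θ ≤ 4 → InnerProductGeometry.angle z.1 z.2 ≤ κ * θ →
      ∀ (c₁ c₂ : Fin n → ℝ) (t : Fin n → Rd d × Rd d), (∀ i, |c₁ i| ≤ κ) → (∀ i, |c₂ i| ≤ κ) →
      (∀ i, relSize z (t i) ≤ κ * θ) →
      ‖iteratedFDeriv ℝ n m z fun i =>
        c₁ i • radialField true z + c₂ i • radialField false z + t i‖ ≤ C * θ := by
  obtain ⟨C₁, hC₁, h₁⟩ := exists_norm_iteratedFDeriv_le.{u} B n
  choose C₂ hC₂ h₂ using exists_norm_iteratedFDeriv_radial_le.{u} (d := d) A n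
  let D : (Fin n → Fin 3) → ℝ := fun σ =>
    C₁ * (4 * κ) ^ n + κ ^ n * (C₂ (fun i => decide (σ i = 0)) * κ)
  have hD : ∀ σ, 0 ≤ D σ := fun σ => by
    have := hC₂ fun i => decide (σ i = 0)
    positivity
  refine ⟨∑ σ, D σ, Finset.sum_nonneg fun σ _ => hD σ, ?_⟩
  intro H _ _ m hm z hz θ hθ0 hθ4 hang c₁ c₂ t hc₁ hc₂ ht
  let g : Fin n → Fin 3 → Rd d × Rd d := fun i =>
    ![c₁ i • radialField true z, c₂ i • radialField false z, t i]
  have hg : (fun i => c₁ i • radialField true z + c₂ i • radialField false z + t i) =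
      fun i => ∑ j, g i j := by
    ext1 i
    simp [g, Fin.sum_univ_three]
  rw [hg, ContinuousMultilinearMap.map_sum, Finset.sum_mul]
  refine (norm_sum_le _ _).trans (Finset.sum_le_sum fun σ _ => ?_)
  have hz1 : ‖z.1‖ ≠ 0 := norm_ne_zero_iff.2 hz.1
  have hz2 : ‖z.2‖ ≠ 0 := norm_ne_zero_iff.2 hz.2
  have hgb : ∀ i j, relSize z (g i j) ≤ 4 * κ := by
    intro i j
    fin_cases j
    · have := hc₁ i
      simp only [g, relSize, radialField_true]
      simp [norm_smul]
      field_simp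
      linarith
    · have := hc₂ i
      simp only [g, relSize, radialField_false]
      simp [norm_smul]
      field_simp
      linarith
    · refine (ht i).trans ?_
      rw [mul_comm]
      gcongr
  by_cases hσ : ∃ i, σ i = 2
  · obtain ⟨i₀, hi₀⟩ := hσ
    refine (h₁ H A m hm z hz _).trans ?_
    have hprod : ∏ i, relSize z (g i (σ i)) ≤ (4 * κ) ^ n * θ := by
      have hn : n = (Finset.univ.erase i₀ : Finset (Fin n)).card + 1 := by
        rw [Finset.card_erase_add_one (Finset.mem_univ _), Finset.card_univ, Fintype.card_fin]
      rw [← Finset.mul_prod_erase _ _ (Finset.mem_univ i₀)]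
      calc _ ≤ (κ * θ) * ∏ i ∈ Finset.univ.erase i₀, 4 * κ := by
            gcongr
            · exact Finset.prod_nonneg fun i _ => relSize_nonneg _ _
            · rw [hi₀]; exact ht i₀
            · intro i _; exact relSize_nonneg _ _
            · exact hgb _ _
        _ = κ * (4 * κ) ^ (Finset.univ.erase i₀ : Finset (Fin n)).card * θ := by
            rw [Finset.prod_const]; ring
        _ ≤ (4 * κ) * (4 * κ) ^ (Finset.univ.erase i₀ : Finset (Fin n)).card * θ := by
            gcongr; linarith
        _ = (4 * κ) ^ n * θ := by
            rw [← pow_succ', ← hn]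
    calc _ ≤ C₁ * ((4 * κ) ^ n * θ) := by gcongr
      _ ≤ D σ * θ := by
        have := hC₂ fun i => decide (σ i = 0)
        rw [← mul_assoc]
        gcongr
        simp only [D]
        have : 0 ≤ κ ^ n * (C₂ (fun i => decide (σ i = 0)) * κ) := by positivity
        linarith
  · push Not at hσ
    let c : Fin n → ℝ := fun i => if σ i = 0 then c₁ i else c₂ i
    have hc : ∀ i, g i (σ i) = c i • radialField (decide (σ i = 0)) z := by
      intro i
      have := hσ i
      have h01 : σ i = 0 ∨ σ i = 1 := by omega
      rcases h01 with h | h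
      · simp [g, c, h]
      · simp [g, c, h]
    have hcκ : ∀ i, ‖c i‖ ≤ κ := by
      intro i
      simp only [c, Real.norm_eq_abs]
      split_ifs
      exacts [hc₁ i, hc₂ i]
    simp_rw [hc]
    rw [ContinuousMultilinearMap.map_smul_univ, norm_smul, norm_prod]
    have h3 := h₂ (fun i => decide (σ i = 0)) H B m hm z hz
    have h4 := hC₂ fun i => decide (σ i = 0)
    calc _ ≤ (∏ i : Fin n, κ) * (C₂ (fun i => decide (σ i = 0)) * (κ * θ)) := by
          gcongr with i
          · exact hcκ i
          · exact h3.trans (by gcongr)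
      _ = κ ^ n * (C₂ (fun i => decide (σ i = 0)) * κ) * θ := by
          rw [Finset.prod_const, Finset.card_univ, Fintype.card_fin]; ring
      _ ≤ D σ * θ := by
          gcongr
          simp only [D]
          have : 0 ≤ C₁ * (4 * κ) ^ n := by positivity
          linarith

end Bounds

/-! ### Rescaling a sector to unit size -/

section Rescaling

open InnerProductGeometry

variable {E : Type*} [NormedAddCommGroup E] [InnerProductSpace ℝ E]

/-- The linear map which is the identity on the axis `ℝ e` and multiplication by `θ` on its
orthogonal complement (for a unit vector `e`). -/
def axialDilation (e : E) (θ : ℝ) : E →L[ℝ] E :=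
  θ • ContinuousLinearMap.id ℝ E + (1 - θ) • (innerSL ℝ e).smulRight e

theorem axialDilation_apply (e : E) (θ : ℝ) (x : E) :
    axialDilation e θ x = θ • x + ((1 - θ) * inner ℝ e x) • e := by
  simp [axialDilation, smul_smul]

theorem axialDilation_eq (e : E) (θ : ℝ) (x : E) :
    axialDilation e θ x = inner ℝ e x • e + θ • (x - inner ℝ e x • e) := by
  rw [axialDilation_apply]
  module

theorem inner_axialDilation {e : E} (he : ‖e‖ = 1) (θ : ℝ) (x : E) :
    inner ℝ e (axialDilation e θ x) = inner ℝ e x := by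
  rw [axialDilation_apply, inner_add_right, inner_smul_right, inner_smul_right,
    real_inner_self_eq_norm_sq, he]
  ring

theorem axialDilation_inv {e : E} (he : ‖e‖ = 1) {θ : ℝ} (hθ : θ ≠ 0) (x : E) :
    axialDilation e θ (axialDilation e θ⁻¹ x) = x := by
  rw [axialDilation_eq e θ, inner_axialDilation he, axialDilation_eq e θ⁻¹, add_sub_cancel_left,
    smul_smul, mul_inv_cancel₀ hθ, one_smul, add_sub_cancel]

theorem inner_sub_inner_smul {e : E} (he : ‖e‖ = 1) (x : E) :
    inner ℝ e (x - inner ℝ e x • e) = 0 := by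
  rw [inner_sub_right, inner_smul_right, real_inner_self_eq_norm_sq, he]
  ring

theorem abs_inner_le_norm_of_unit {e : E} (he : ‖e‖ = 1) (x : E) : |inner ℝ e x| ≤ ‖x‖ := by
  simpa [he] using abs_real_inner_le_norm e x

theorem norm_sub_inner_smul_sq {e : E} (he : ‖e‖ = 1) (x : E) :
    ‖x - inner ℝ e x • e‖ ^ 2 = ‖x‖ ^ 2 - inner ℝ e x ^ 2 := by
  rw [norm_sub_sq_real, inner_smul_right, norm_smul, he, real_inner_comm, Real.norm_eq_abs,
    mul_one, sq_abs]
  ring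

theorem norm_sub_inner_smul_le {e : E} (he : ‖e‖ = 1) (x : E) :
    ‖x - inner ℝ e x • e‖ ≤ ‖x‖ := by
  refine le_of_sq_le_sq ?_ (norm_nonneg x)
  rw [norm_sub_inner_smul_sq he]; nlinarith [sq_nonneg (inner ℝ e x)]

/-- The linear map carrying the unit-size region around the axis `e` onto a sector of size `s` and
angular width `θ` around the axis `R e`. -/
def sectorMap (R : E ≃ₗᵢ[ℝ] E) (e : E) (s θ : ℝ) : E →L[ℝ] E :=
  s • (R.toContinuousLinearEquiv : E →L[ℝ] E).comp (axialDilation e θ)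

/-- The inverse of `sectorMap`. -/
def sectorMapInv (R : E ≃ₗᵢ[ℝ] E) (e : E) (s θ : ℝ) : E →L[ℝ] E :=
  s⁻¹ • (axialDilation e θ⁻¹).comp (R.symm.toContinuousLinearEquiv : E →L[ℝ] E)

theorem sectorMap_apply (R : E ≃ₗᵢ[ℝ] E) (e : E) (s θ : ℝ) (x : E) :
    sectorMap R e s θ x = s • R (axialDilation e θ x) := rfl

theorem sectorMapInv_apply (R : E ≃ₗᵢ[ℝ] E) (e : E) (s θ : ℝ) (ξ : E) :
    sectorMapInv R e s θ ξ = s⁻¹ • axialDilation e θ⁻¹ (R.symm ξ) := rfl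

variable {R : E ≃ₗᵢ[ℝ] E} {e : E} {s θ : ℝ}

theorem sectorMap_sectorMapInv (he : ‖e‖ = 1) (hs : s ≠ 0) (hθ : θ ≠ 0) (ξ : E) :
    sectorMap R e s θ (sectorMapInv R e s θ ξ) = ξ := by
  rw [sectorMap_apply, sectorMapInv_apply, map_smul, map_smul, axialDilation_inv he hθ,
    R.apply_symm_apply, smul_smul, mul_inv_cancel₀ hs, one_smul]

theorem norm_sectorMap (hs : 0 < s) (x : E) :
    ‖sectorMap R e s θ x‖ = s * ‖axialDilation e θ x‖ := by
  rw [sectorMap_apply, norm_smul, R.norm_map, Real.norm_of_nonneg hs.le]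

theorem mul_inner_le_norm_sectorMap (he : ‖e‖ = 1) (hs : 0 < s) (x : E) :
    s * inner ℝ e x ≤ ‖sectorMap R e s θ x‖ := by
  rw [norm_sectorMap hs]
  gcongr
  have := abs_inner_le_norm_of_unit he (axialDilation e θ x)
  rw [inner_axialDilation he] at this
  exact (le_abs_self _).trans this

/-- The angle between a point of the rescaled region and the axis of its sector is `O(θ)`. -/
theorem angle_sectorMap_le (he : ‖e‖ = 1) (hs : 0 < s) (hθ : 0 ≤ θ) {x : E}
    (hx : 1 / 400 < inner ℝ e x) (hx' : ‖x‖ < 400) :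
    angle (R e) (sectorMap R e s θ x) ≤ 160000 * θ := by
  have ha : 0 < inner ℝ e x := by linarith
  rw [sectorMap_apply, angle_smul_right_of_pos _ _ hs]
  have h := R.toLinearIsometry.angle_map e (axialDilation e θ x)
  have h' : angle (R e) (R (axialDilation e θ x)) = angle e (axialDilation e θ x) := h
  rw [h', ← angle_smul_left_of_pos _ _ ha, axialDilation_eq, angle_add_eq_arctan_of_inner_eq_zero]
  · have hle : ‖θ • (x - inner ℝ e x • e)‖ / ‖inner ℝ e x • e‖ ≤ 160000 * θ := by
      rw [norm_smul, norm_smul, he, Real.norm_of_nonneg hθ, Real.norm_of_nonneg ha.le, mul_one,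
        div_le_iff₀ ha]
      have := norm_sub_inner_smul_le he x
      calc θ * ‖x - inner ℝ e x • e‖ ≤ θ * 400 := by gcongr; linarith
        _ = 160000 * θ * (1 / 400) := by ring
        _ ≤ _ := by gcongr
    refine le_trans ?_ hle
    have h0 : 0 ≤ ‖θ • (x - inner ℝ e x • e)‖ / ‖inner ℝ e x • e‖ := by positivity
    have h1 := Real.le_tan (Real.arctan_nonneg.2 h0) (Real.arctan_lt_pi_div_two _)
    rwa [Real.tan_arctan] at h1
  · rw [inner_smul_left, inner_smul_right, inner_sub_inner_smul he]
    simp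
  · exact smul_ne_zero ha.ne' (norm_ne_zero_iff.1 (by rw [he]; exact one_ne_zero))

/-- On the rescaled region, the image of a unit vector under the rescaling is a bounded multiple of
the radial direction, up to an error of relative size `O(θ)`. -/
theorem exists_radial_decomposition (he : ‖e‖ = 1) (hs : 0 < s) (hθ : 0 ≤ θ) {x u : E}
    (hx : 1 / 400 < inner ℝ e x) (hx' : ‖x‖ < 400) (hu : ‖u‖ ≤ 1) :
    ∃ (c : ℝ) (t : E), sectorMap R e s θ u = c • sectorMap R e s θ x + t ∧ |c| ≤ 400 ∧
      ‖sectorMap R e s θ x‖⁻¹ * ‖t‖ ≤ 10 ^ 8 * θ := by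
  have ha : 0 < inner ℝ e x := by linarith
  set c : ℝ := inner ℝ e u / inner ℝ e x with hc
  have hc400 : |c| ≤ 400 := by
    rw [hc, abs_div, abs_of_pos ha, div_le_iff₀ ha]
    have := abs_inner_le_norm_of_unit he u
    linarith
  refine ⟨c, sectorMap R e s θ (u - c • x), by rw [map_sub, map_smul]; abel, hc400, ?_⟩
  have h0 : inner ℝ e (u - c • x) = 0 := by
    rw [inner_sub_right, inner_smul_right, hc, div_mul_cancel₀ _ ha.ne', sub_self]
  have hn : ‖u - c • x‖ ≤ 160001 := by
    calc ‖u - c • x‖ ≤ ‖u‖ + ‖c • x‖ := norm_sub_le _ _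
      _ = ‖u‖ + |c| * ‖x‖ := by rw [norm_smul, Real.norm_eq_abs]
      _ ≤ 1 + 400 * 400 := by gcongr
      _ = _ := by norm_num
  have hT : s * (1 / 400) ≤ ‖sectorMap R e s θ x‖ :=
    (by gcongr : s * (1 / 400) ≤ s * inner ℝ e x).trans (mul_inner_le_norm_sectorMap he hs x)
  have hpos : 0 < ‖sectorMap R e s θ x‖ := lt_of_lt_of_le (by positivity) hT
  rw [inv_mul_le_iff₀ hpos, norm_sectorMap hs, axialDilation_eq, h0, zero_smul, zero_add, sub_zero,
    norm_smul, Real.norm_of_nonneg hθ]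
  calc s * (θ * ‖u - c • x‖) ≤ s * (θ * 160001) := by gcongr
    _ ≤ s * (1 / 400) * (10 ^ 8 * θ) := by nlinarith [mul_nonneg hs.le hθ]
    _ ≤ _ := by gcongr

/-- A truncated cone around the axis `R e`, of angular radius at most `θ`, is contained in the image
of a fixed bounded region. -/
theorem sectorMapInv_mem (he : ‖e‖ = 1) (hs : 0 < s) (hθ : 0 < θ) {ξ : E}
    (h1 : 1 / 100 * s < ‖ξ‖) (h2 : ‖ξ‖ < 100 * s) (hang : angle (R e) ξ ≤ θ)
    (hang' : angle (R e) ξ ≤ 1) :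
    1 / 200 ≤ inner ℝ e (sectorMapInv R e s θ ξ) ∧ ‖sectorMapInv R e s θ ξ‖ ≤ 200 := by
  set φ := angle (R e) ξ with hφ
  have hφ0 : 0 ≤ φ := angle_nonneg _ _
  set y := R.symm ξ with hy
  have hyn : ‖y‖ = ‖ξ‖ := R.symm.norm_map ξ
  have hey : inner ℝ e y = ‖ξ‖ * Real.cos φ := by
    have h : inner ℝ (R e) (R y) = inner ℝ e y := R.inner_map_map e y
    rw [← h, hy, R.apply_symm_apply, hφ, ← cos_angle_mul_norm_mul_norm, R.norm_map, he]
    ring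
  have hcos : 1 / 2 ≤ Real.cos φ := by
    have := Real.one_sub_sq_div_two_le_cos (x := φ)
    nlinarith
  rw [sectorMapInv_apply]
  constructor
  · rw [inner_smul_right, inner_axialDilation he, hey, ← div_eq_inv_mul, le_div_iff₀ hs]
    nlinarith [norm_nonneg ξ]
  · have hperp : ‖y - inner ℝ e y • e‖ ≤ ‖ξ‖ * θ := by
      refine le_of_sq_le_sq ?_ (by positivity)
      rw [norm_sub_inner_smul_sq he, hyn, hey]
      have hsin : Real.sin φ ^ 2 ≤ θ ^ 2 := by
        rw [sq_le_sq, abs_of_pos hθ]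
        refine (Real.abs_sin_le_abs (x := φ)).trans ?_
        rwa [abs_of_nonneg hφ0]
      calc ‖ξ‖ ^ 2 - (‖ξ‖ * Real.cos φ) ^ 2 = ‖ξ‖ ^ 2 * Real.sin φ ^ 2 := by
            rw [Real.sin_sq]; ring
        _ ≤ ‖ξ‖ ^ 2 * θ ^ 2 := by gcongr
        _ = _ := by ring
    rw [norm_smul, Real.norm_of_nonneg (by positivity), axialDilation_eq, inv_mul_le_iff₀ hs]
    calc _ ≤ ‖inner ℝ e y • e‖ + ‖θ⁻¹ • (y - inner ℝ e y • e)‖ := norm_add_le _ _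
      _ = |inner ℝ e y| + θ⁻¹ * ‖y - inner ℝ e y • e‖ := by
          rw [norm_smul, norm_smul, he, mul_one, Real.norm_eq_abs,
            Real.norm_of_nonneg (by positivity)]
      _ ≤ ‖ξ‖ + θ⁻¹ * (‖ξ‖ * θ) := by
          gcongr
          rw [← hyn]
          exact abs_inner_le_norm_of_unit he y
      _ = 2 * ‖ξ‖ := by field_simp; ring
      _ ≤ s * 200 := by linarith

theorem exists_isometry_map_eq {p : E} (he : ‖e‖ = 1) (hp : ‖p‖ = 1) :
    ∃ R : E ≃ₗᵢ[ℝ] E, R e = p :=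
  ⟨(Submodule.span ℝ {e - p})ᗮ.reflection, Submodule.reflection_sub (he.trans hp.symm)⟩

end Rescaling

/-! ### Caps -/

section Caps

open InnerProductGeometry

variable {d : ℕ}

/-- `p` is a centre of the cap `Ω` of radius `r`. -/
def IsCapCentre (Ω : Set (Rd d)) (r : ℝ) (p : Rd d) : Prop :=
  ‖p‖ = 1 ∧ p ∈ Ω ∧ ∀ x ∈ Ω, ‖x‖ = 1 ∧ angle p x ≤ r

theorem IsAngularCap.exists_centre {Ω : Set (Rd d)} {r : ℝ} (h : IsAngularCap Ω r) :
    ∃ p, IsCapCentre Ω r p := by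
  obtain ⟨hr, p, hp, h | h⟩ := h
  · refine ⟨p, hp, ?_, ?_⟩
    · rw [h]
      refine ⟨hp, ?_⟩
      rw [angle_self (norm_ne_zero_iff.1 (by rw [hp]; exact one_ne_zero))]
      exact hr
    · rw [h]
      exact fun x hx => ⟨hx.1, hx.2.le⟩
  · refine ⟨p, hp, ?_, ?_⟩
    · rw [h]
      refine ⟨hp, ?_⟩
      rw [angle_self (norm_ne_zero_iff.1 (by rw [hp]; exact one_ne_zero))]
      exact hr.le
    · rw [h]
      exact fun x hx => ⟨hx.1, hx.2⟩

theorem angle_centres_le {Ω₁ Ω₂ : Set (Rd d)} {r₁ r₂ : ℝ} {p₁ p₂ : Rd d}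
    (h₁ : IsCapCentre Ω₁ r₁ p₁) (h₂ : IsCapCentre Ω₂ r₂ p₂) :
    angle p₁ p₂ ≤ angularDist Ω₁ Ω₂ + r₁ + r₂ := by
  have : angle p₁ p₂ - r₁ - r₂ ≤ angularDist Ω₁ Ω₂ := by
    refine le_csInf ⟨_, p₁, h₁.2.1, p₂, h₂.2.1, rfl⟩ ?_
    rintro _ ⟨ξ, hξ, η, hη, rfl⟩
    have a1 := angle_le_angle_add_angle p₁ ξ p₂
    have a2 := angle_le_angle_add_angle ξ η p₂
    have a3 := (h₁.2.2 ξ hξ).2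
    have a4 := (h₂.2.2 η hη).2
    rw [angle_comm] at a4
    linarith
  linarith

theorem angularDist_le_pi {Ω₁ Ω₂ : Set (Rd d)} {r₁ r₂ : ℝ} {p₁ p₂ : Rd d}
    (h₁ : IsCapCentre Ω₁ r₁ p₁) (h₂ : IsCapCentre Ω₂ r₂ p₂) :
    angularDist Ω₁ Ω₂ ≤ Real.pi := by
  refine le_trans (csInf_le (a := angle p₁ p₂) ⟨0, ?_⟩ ⟨p₁, h₁.2.1, p₂, h₂.2.1, rfl⟩)
    (angle_le_pi p₁ p₂)
  rintro _ ⟨ξ, _, η, _, rfl⟩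
  exact angle_nonneg _ _

theorem IsCapCentre.angle_le_of_mem_sector {Ω : Set (Rd d)} {r : ℝ} {p ξ : Rd d} {k : ℤ}
    (h : IsCapCentre Ω r p) (hξ : ξ ∈ sector k Ω) : angle p ξ ≤ r := by
  have hpos : 0 < ‖ξ‖ := lt_trans (by positivity) hξ.1
  have := (h.2.2 _ hξ.2.2).2
  rwa [angle_smul_right_of_pos _ _ (inv_pos.2 hpos)] at this

end Caps

/-! ### The localized symbol -/

section Localization

open InnerProductGeometry

universe u

variable {d : ℕ}

/-- The rescaled frequency space: `ℝ^d × ℝ^d` with its Euclidean norm. -/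
abbrev FreqSpace (d : ℕ) : Type := WithLp 2 (Rd d × Rd d)

theorem norm_fst_le (w : FreqSpace d) : ‖w.fst‖ ≤ ‖w‖ := by
  rw [WithLp.prod_norm_eq_of_L2]
  exact Real.le_sqrt_of_sq_le (by nlinarith [sq_nonneg ‖w.snd‖])

theorem norm_snd_le (w : FreqSpace d) : ‖w.snd‖ ≤ ‖w‖ := by
  rw [WithLp.prod_norm_eq_of_L2]
  exact Real.le_sqrt_of_sq_le (by nlinarith [sq_nonneg ‖w.fst‖])

theorem norm_le_fst_add_snd (w : FreqSpace d) : ‖w‖ ≤ ‖w.fst‖ + ‖w.snd‖ := by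
  rw [WithLp.prod_norm_eq_of_L2]
  refine Real.sqrt_le_left (by positivity) |>.2 ?_
  nlinarith [mul_nonneg (norm_nonneg w.fst) (norm_nonneg w.snd)]

theorem continuous_freq_fst : Continuous fun w : FreqSpace d => w.fst :=
  (WithLp.fstL 2 ℝ (Rd d) (Rd d)).continuous

theorem continuous_freq_snd : Continuous fun w : FreqSpace d => w.snd :=
  (WithLp.sndL 2 ℝ (Rd d) (Rd d)).continuous

/-- The open region of the points whose components both have norm less than `b` and component along
`e` greater than `a`. -/
def openRegion (e : Rd d) (a b : ℝ) : Set (FreqSpace d) :=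
  {w | (a < inner ℝ e w.fst ∧ ‖w.fst‖ < b) ∧ a < inner ℝ e w.snd ∧ ‖w.snd‖ < b}

/-- The analogue of `openRegion` with non-strict inequalities. -/
def closedRegion (e : Rd d) (a b : ℝ) : Set (FreqSpace d) :=
  {w | (a ≤ inner ℝ e w.fst ∧ ‖w.fst‖ ≤ b) ∧ a ≤ inner ℝ e w.snd ∧ ‖w.snd‖ ≤ b}

theorem isOpen_openRegion (e : Rd d) (a b : ℝ) : IsOpen (openRegion e a b) := by
  have h1 := continuous_freq_fst (d := d)
  have h2 := continuous_freq_snd (d := d)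
  have h3 : Continuous fun w : FreqSpace d => (inner ℝ e w.fst : ℝ) := by fun_prop
  have h4 : Continuous fun w : FreqSpace d => (inner ℝ e w.snd : ℝ) := by fun_prop
  exact ((isOpen_lt continuous_const h3).inter
    (isOpen_lt h1.norm continuous_const)).inter
    ((isOpen_lt continuous_const h4).inter
      (isOpen_lt h2.norm continuous_const))

theorem isClosed_closedRegion (e : Rd d) (a b : ℝ) : IsClosed (closedRegion e a b) := by
  have h1 := continuous_freq_fst (d := d)
  have h2 := continuous_freq_snd (d := d)
  have h3 : Continuous fun w : FreqSpace d => (inner ℝ e w.fst : ℝ) := by fun_prop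
  have h4 : Continuous fun w : FreqSpace d => (inner ℝ e w.snd : ℝ) := by fun_prop
  exact ((isClosed_le continuous_const h3).inter
    (isClosed_le h1.norm continuous_const)).inter
    ((isClosed_le continuous_const h4).inter
      (isClosed_le h2.norm continuous_const))

/-- The bounded open region around the axis `e`, in both variables, in which rescaled symbols are
studied. -/
abbrev unitRegion (e : Rd d) : Set (FreqSpace d) := openRegion e (1 / 400) 400

theorem exists_cutoff (e : Rd d) : ∃ χ : FreqSpace d → ℝ, ContDiff ℝ ∞ χ ∧ HasCompactSupport χ ∧
    tsupport χ ⊆ unitRegion e ∧ ∀ w ∈ closedRegion e (1 / 200) 200, χ w = 1 := by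
  have hso : closedRegion e (1 / 200) 200 ⊆ openRegion e (1 / 300) 300 := by
    rintro w ⟨⟨a, b⟩, c, d⟩
    refine ⟨⟨?_, ?_⟩, ?_, ?_⟩ <;> linarith
  have hot : openRegion e (1 / 300) 300 ⊆ interior (closedRegion e (1 / 300) 300) :=
    interior_maximal (fun w hw => ⟨⟨hw.1.1.le, hw.1.2.le⟩, hw.2.1.le, hw.2.2.le⟩)
      (isOpen_openRegion e _ _)
  obtain ⟨f, hf1, hf0, -⟩ := exists_contMDiffMap_one_nhds_of_subset_interior
    (n := ⊤) (modelWithCornersSelf ℝ (FreqSpace d)) (isClosed_closedRegion e _ _) (hso.trans hot)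
  have hsupp : tsupport f ⊆ closedRegion e (1 / 300) 300 := by
    refine closure_minimal (fun w hw => ?_) (isClosed_closedRegion e _ _)
    by_contra h
    exact hw (hf0 w h)
  refine ⟨f, f.contMDiff.contDiff, ?_, ?_, fun w hw => hf1.self_of_nhdsSet w hw⟩
  · refine HasCompactSupport.of_support_subset_isCompact
      (isCompact_closedBall (0 : FreqSpace d) 600) fun w hw => ?_
    have h := hsupp (subset_tsupport _ hw)
    rw [mem_closedBall_zero_iff]
    refine (norm_le_fst_add_snd w).trans ?_
    linarith [h.1.2, h.2.2]
  · intro w hw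
    obtain ⟨⟨a, b⟩, c, d⟩ := hsupp hw
    refine ⟨⟨?_, ?_⟩, ?_, ?_⟩ <;> linarith

/-- The pair of rescalings `(T₁, T₂)` as a map from the rescaled frequency space. -/
def freqMap (T₁ T₂ : Rd d →L[ℝ] Rd d) : FreqSpace d →L[ℝ] Rd d × Rd d :=
  (T₁.comp (WithLp.fstL 2 ℝ (Rd d) (Rd d))).prod (T₂.comp (WithLp.sndL 2 ℝ (Rd d) (Rd d)))

theorem freqMap_apply (T₁ T₂ : Rd d →L[ℝ] Rd d) (w : FreqSpace d) :
    freqMap T₁ T₂ w = (T₁ w.fst, T₂ w.snd) := rfl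

variable {e : Rd d} {R₁ R₂ : Rd d ≃ₗᵢ[ℝ] Rd d} {s₁ s₂ θ : ℝ}

theorem freqMap_mem_regularSet (he : ‖e‖ = 1) (hs₁ : 0 < s₁) (hs₂ : 0 < s₂) {w : FreqSpace d}
    (hw : w ∈ unitRegion e) :
    freqMap (sectorMap R₁ e s₁ θ) (sectorMap R₂ e s₂ θ) w ∈ regularSet d := by
  obtain ⟨⟨a, -⟩, b, -⟩ := hw
  constructor
  · refine norm_pos_iff.1 (lt_of_lt_of_le ?_ (mul_inner_le_norm_sectorMap he hs₁ w.fst))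
    have : 0 < inner ℝ e w.fst := by linarith
    positivity
  · refine norm_pos_iff.1 (lt_of_lt_of_le ?_ (mul_inner_le_norm_sectorMap he hs₂ w.snd))
    have : 0 < inner ℝ e w.snd := by linarith
    positivity

theorem contDiffOn_comp_freqMap (he : ‖e‖ = 1) (hs₁ : 0 < s₁) (hs₂ : 0 < s₂) {H : Type*}
    [NormedAddCommGroup H] [NormedSpace ℝ H] {A : ℕ → ℕ → ℝ} {B : (Fin d → ℕ) → (Fin d → ℕ) → ℝ}
    {m : Rd d × Rd d → H} (hm : IsAbstractNullForm A B m) :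
    ContDiffOn ℝ ∞ (m ∘ freqMap (sectorMap R₁ e s₁ θ) (sectorMap R₂ e s₂ θ)) (unitRegion e) :=
  hm.contDiffOn.comp (ContinuousLinearMap.contDiff _).contDiffOn
    fun _ hw => freqMap_mem_regularSet he hs₁ hs₂ hw

theorem iteratedFDeriv_comp_clm {E F H : Type*} [NormedAddCommGroup E] [NormedSpace ℝ E]
    [NormedAddCommGroup F] [NormedSpace ℝ F] [NormedAddCommGroup H] [NormedSpace ℝ H] {Ω : Set E}
    (hΩ : IsOpen Ω) {u : E → H} (hu : ContDiffOn ℝ ∞ u Ω) (L : F →L[ℝ] E) {w : F} (hw : L w ∈ Ω)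
    (n : ℕ) : iteratedFDeriv ℝ n (u ∘ L) w =
      (iteratedFDeriv ℝ n u (L w)).compContinuousLinearMap fun _ => L := by
  have hpre : IsOpen (L ⁻¹' Ω) := hΩ.preimage L.continuous
  rw [← iteratedFDerivWithin_of_isOpen n hpre hw, ← iteratedFDerivWithin_of_isOpen n hΩ hw]
  exact L.iteratedFDerivWithin_comp_right hu hΩ.uniqueDiffOn hpre.uniqueDiffOn hw (mod_cast le_top)

/-- The derivatives of the rescaled symbol are `O(θ)`. -/
theorem exists_norm_iteratedFDeriv_comp_freqMap_le (A : ℕ → ℕ → ℝ)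
    (B : (Fin d → ℕ) → (Fin d → ℕ) → ℝ) (n : ℕ) :
    ∃ C : ℝ, 0 ≤ C ∧ ∀ (H : Type u) [NormedAddCommGroup H] [NormedSpace ℝ H]
      (m : Rd d × Rd d → H), IsAbstractNullForm A B m →
      ∀ (e : Rd d) (R₁ R₂ : Rd d ≃ₗᵢ[ℝ] Rd d) (s₁ s₂ θ : ℝ), ‖e‖ = 1 → 0 < s₁ → 0 < s₂ → 0 < θ →
      θ ≤ 4 → angle (R₁ e) (R₂ e) ≤ 3 * θ → ∀ w ∈ unitRegion e,
      ‖iteratedFDeriv ℝ n (m ∘ freqMap (sectorMap R₁ e s₁ θ) (sectorMap R₂ e s₂ θ)) w‖ ≤ C * θ := by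
  obtain ⟨C, hC, h⟩ := exists_norm_iteratedFDeriv_le_mul.{u} A B (10 ^ 9) (by norm_num) n
  refine ⟨C, hC, ?_⟩
  intro H _ _ m hm e R₁ R₂ s₁ s₂ θ he hs₁ hs₂ hθ hθ4 hang w hw
  set L := freqMap (sectorMap R₁ e s₁ θ) (sectorMap R₂ e s₂ θ) with hL
  have hz : L w ∈ regularSet d := freqMap_mem_regularSet he hs₁ hs₂ hw
  have hcomp : iteratedFDeriv ℝ n (m ∘ L) w =
      (iteratedFDeriv ℝ n m (L w)).compContinuousLinearMap fun _ => L :=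
    iteratedFDeriv_comp_clm isOpen_regularSet hm.contDiffOn L hz n
  obtain ⟨⟨a₁, b₁⟩, a₂, b₂⟩ := hw
  have hangle : angle (L w).1 (L w).2 ≤ 10 ^ 9 * θ := by
    have t1 := angle_le_angle_add_angle (L w).1 (R₁ e) (L w).2
    have t2 := angle_le_angle_add_angle (R₁ e) (R₂ e) (L w).2
    have t3 : angle (R₁ e) (L w).1 ≤ _ := angle_sectorMap_le (R := R₁) he hs₁ hθ.le a₁ b₁
    have t4 : angle (R₂ e) (L w).2 ≤ _ := angle_sectorMap_le (R := R₂) he hs₂ hθ.le a₂ b₂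
    rw [angle_comm] at t3
    linarith
  -- vectors of norm at most `1`
  have hunit : ∀ v : Fin n → FreqSpace d, (∀ i, ‖v i‖ ≤ 1) →
      ‖iteratedFDeriv ℝ n m (L w) fun i => L (v i)‖ ≤ C * θ := by
    intro v hv
    choose c₁ t₁ e₁ hc₁ ht₁ using fun i => exists_radial_decomposition (R := R₁) he hs₁ hθ.le a₁ b₁
      ((norm_fst_le (v i)).trans (hv i))
    choose c₂ t₂ e₂ hc₂ ht₂ using fun i => exists_radial_decomposition (R := R₂) he hs₂ hθ.le a₂ b₂
      ((norm_snd_le (v i)).trans (hv i))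
    have hdec : (fun i => L (v i)) = fun i => c₁ i • radialField true (L w) +
        c₂ i • radialField false (L w) + (t₁ i, t₂ i) := by
      ext1 i
      rw [radialField_true, radialField_false, hL, freqMap_apply, freqMap_apply, e₁, e₂]
      simp
    rw [hdec]
    refine h H m hm (L w) hz θ hθ.le hθ4 hangle c₁ c₂ _ (fun i => (hc₁ i).trans (by norm_num))
      (fun i => (hc₂ i).trans (by norm_num)) fun i => ?_
    have := ht₁ i
    have := ht₂ i
    change ‖sectorMap R₁ e s₁ θ w.fst‖⁻¹ * ‖t₁ i‖ + ‖sectorMap R₂ e s₂ θ w.snd‖⁻¹ * ‖t₂ i‖ ≤ _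
    linarith
  refine ContinuousMultilinearMap.opNorm_le_bound (by positivity) fun v => ?_
  rw [hcomp, ContinuousMultilinearMap.compContinuousLinearMap_apply]
  have hv : (fun i => L (v i)) = fun i => ‖v i‖ • L (‖v i‖⁻¹ • v i) := by
    ext1 i
    rw [map_smul, smul_smul]
    by_cases h0 : v i = 0
    · simp [h0]
    · rw [mul_inv_cancel₀ (norm_ne_zero_iff.2 h0), one_smul]
  rw [hv, ContinuousMultilinearMap.map_smul_univ, norm_smul, norm_prod, mul_comm]
  simp only [norm_norm]
  gcongr
  refine hunit _ fun i => ?_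
  rw [norm_smul, norm_inv, norm_norm]
  exact inv_mul_le_one

/-- On products of sectors, a null form is a superposition of characters with total mass `O(θ)`. -/
theorem exists_kernel_on_sectors (hd : 0 < d) (A : ℕ → ℕ → ℝ)
    (B : (Fin d → ℕ) → (Fin d → ℕ) → ℝ) :
    ∃ C : ℝ, 0 ≤ C ∧ ∀ (H : Type u) [NormedAddCommGroup H] [NormedSpace ℂ H] [CompleteSpace H]
      (m : Rd d × Rd d → H), IsAbstractNullForm A B m →
      ∀ (Ω₁ Ω₂ : Set (Rd d)) (r₁ r₂ : ℝ) (p₁ p₂ : Rd d) (k₁ k₂ : ℤ) (θ : ℝ),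
      IsCapCentre Ω₁ r₁ p₁ → IsCapCentre Ω₂ r₂ p₂ → r₁ ≤ 1 → r₂ ≤ 1 → r₁ ≤ θ → r₂ ≤ θ → 0 < θ →
      θ ≤ 4 → angle p₁ p₂ ≤ 3 * θ →
      ∃ (K : FreqSpace d → H) (a b : FreqSpace d → Rd d), Continuous K ∧ Integrable K ∧
        Continuous a ∧ Continuous b ∧ ∫⁻ w, ‖K w‖ₑ ≤ ENNReal.ofReal (C * θ) ∧
        ∀ ξ ∈ sector k₁ Ω₁, ∀ η ∈ sector k₂ Ω₂, m (ξ, η) =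
          ∫ w, Complex.exp (Complex.I * ((inner ℝ (a w) ξ + inner ℝ (b w) η : ℝ) : ℂ)) • K w := by
  set e : Rd d := EuclideanSpace.single ⟨0, hd⟩ 1 with he_def
  have he : ‖e‖ = 1 := by simp [he_def]
  obtain ⟨χ, hχ, hχc, hχs, hχ1⟩ := exists_cutoff e
  obtain ⟨C₀, hC₀, hker⟩ := exists_kernel.{0, u} hχ hχc
  set N := Module.finrank ℝ (FreqSpace d) + 1
  choose c hc0 hc using fun n => exists_norm_iteratedFDeriv_comp_freqMap_le.{u} (d := d) A B n
  set D : ℝ := ∑ n ∈ Finset.range (N + 1), c n with hD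
  have hcD : ∀ n ≤ N, c n ≤ D := fun n hn =>
    Finset.single_le_sum (fun n _ => hc0 n) (Finset.mem_range.2 (by omega))
  have hD0 : 0 ≤ D := Finset.sum_nonneg fun n _ => hc0 n
  refine ⟨C₀ * D, by positivity, ?_⟩
  intro H _ _ _ m hm Ω₁ Ω₂ r₁ r₂ p₁ p₂ k₁ k₂ θ h₁ h₂ hr₁ hr₂ hθ₁ hθ₂ hθ hθ4 hang
  obtain ⟨R₁, rfl⟩ := exists_isometry_map_eq he h₁.1
  obtain ⟨R₂, rfl⟩ := exists_isometry_map_eq he h₂.1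
  have hs₁ : (0 : ℝ) < 2 ^ k₁ := by positivity
  have hs₂ : (0 : ℝ) < 2 ^ k₂ := by positivity
  set T₁ := sectorMap R₁ e (2 ^ k₁) θ with hT₁
  set T₂ := sectorMap R₂ e (2 ^ k₂) θ with hT₂
  set S₁ := sectorMapInv R₁ e (2 ^ k₁) θ with hS₁
  set S₂ := sectorMapInv R₂ e (2 ^ k₂) θ with hS₂
  obtain ⟨K, hK, hKi, hKb, hKr⟩ := hker H (m ∘ freqMap T₁ T₂) (unitRegion e) (D * θ)
    (isOpen_openRegion e _ _) hχs (contDiffOn_comp_freqMap he hs₁ hs₂ hm) (by positivity)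
    (fun n hn w hw => (hc n H m hm e R₁ R₂ _ _ θ he hs₁ hs₂ hθ hθ4 hang w (hχs hw)).trans
      (by gcongr; exact hcD n hn))
  refine ⟨K, fun w => (2 * Real.pi) • ContinuousLinearMap.adjoint S₁ w.fst,
    fun w => (2 * Real.pi) • ContinuousLinearMap.adjoint S₂ w.snd, hK, hKi, ?_, ?_, ?_, ?_⟩
  · have := (ContinuousLinearMap.adjoint S₁).continuous.comp (continuous_freq_fst (d := d))
    exact this.const_smul (2 * Real.pi)
  · have := (ContinuousLinearMap.adjoint S₂).continuous.comp (continuous_freq_snd (d := d))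
    exact this.const_smul (2 * Real.pi)
  · rwa [mul_assoc]
  · intro ξ hξ η hη
    set w : FreqSpace d := WithLp.toLp 2 (S₁ ξ, S₂ η) with hw
    have hχw : χ w = 1 := by
      refine hχ1 w ⟨?_, ?_⟩
      · exact sectorMapInv_mem he hs₁ hθ hξ.1 hξ.2.1 ((h₁.angle_le_of_mem_sector hξ).trans hθ₁)
          ((h₁.angle_le_of_mem_sector hξ).trans hr₁)
      · exact sectorMapInv_mem he hs₂ hθ hη.1 hη.2.1 ((h₂.angle_le_of_mem_sector hη).trans hθ₂)
          ((h₂.angle_le_of_mem_sector hη).trans hr₂)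
    have hmw : (m ∘ freqMap T₁ T₂) w = m (ξ, η) := by
      rw [Function.comp_apply, freqMap_apply]
      congr 2
      · exact sectorMap_sectorMapInv he hs₁.ne' hθ.ne' ξ
      · exact sectorMap_sectorMapInv he hs₂.ne' hθ.ne' η
    rw [← hmw, hKr w hχw]
    congr 1 with v
    congr 4
    rw [WithLp.prod_inner_apply, inner_smul_left, inner_smul_left,
      ContinuousLinearMap.adjoint_inner_left, ContinuousLinearMap.adjoint_inner_left]
    simp only [conj_trivial, hw]
    rw [mul_add]
    rfl

end Localization

universe u₀ u₁ u₂ u₃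

/-- The bilinear estimate, for symbols with values in a space `H` that acts on `F₁ × F₂` through
a bilinear-map-valued `T` of norm at most `1`. -/
theorem exists_eLpNorm_bilinearOp_le {d : ℕ} (hd : 0 < d) (A : ℕ → ℕ → ℝ)
    (B : (Fin d → ℕ) → (Fin d → ℕ) → ℝ) :
    ∃ C : ℝ, 0 < C ∧
      ∀ (H : Type u₀) (F₁ : Type u₁) (F₂ : Type u₂) (G : Type u₃)
        [NormedAddCommGroup H] [NormedSpace ℂ H] [CompleteSpace H]
        [NormedAddCommGroup F₁] [NormedSpace ℂ F₁] [CompleteSpace F₁]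
        [NormedAddCommGroup F₂] [NormedSpace ℂ F₂] [CompleteSpace F₂]
        [NormedAddCommGroup G] [NormedSpace ℂ G] [CompleteSpace G]
        (T : H →L[ℂ] F₁ →L[ℂ] F₂ →L[ℂ] G), (∀ h u v, ‖T h u v‖ ≤ ‖h‖ * ‖u‖ * ‖v‖) →
      ∀ (m : Rd d × Rd d → H), IsAbstractNullForm A B m →
      ∀ (ω₁ ω₂ : Set (Rd d)) (r₁ r₂ : ℝ), IsAngularCap ω₁ r₁ → IsAngularCap ω₂ r₂ →
        r₁ ≤ 1 → r₂ ≤ 1 →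
      ∀ (k₁ k₂ : ℤ) (f₁ : 𝓢(Rd d, F₁)) (f₂ : 𝓢(Rd d, F₂)),
        tsupport (hat f₁) ⊆ sector k₁ ω₁ → tsupport (hat f₂) ⊆ sector k₂ ω₂ →
      ∀ p q₁ q₂ : ℝ≥0∞, 1 ≤ p → p⁻¹ = q₁⁻¹ + q₂⁻¹ →
        eLpNorm (bilinearOp (fun z => T (m z)) f₁ f₂) p volume ≤
          ENNReal.ofReal (C * max (angularDist ω₁ ω₂) (max r₁ r₂)) *
            eLpNorm f₁ q₁ volume * eLpNorm f₂ q₂ volume := by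
  obtain ⟨C, hC, hker⟩ := exists_kernel_on_sectors.{u₀} hd A B
  refine ⟨C + 1, by positivity, ?_⟩
  intro H F₁ F₂ G _ _ _ _ _ _ _ _ _ _ _ _ T hT m hm ω₁ ω₂ r₁ r₂ hω₁ hω₂ hr₁ hr₂ k₁ k₂ f₁ f₂
    hf₁ hf₂ p q₁ q₂ hp hpq
  obtain ⟨p₁, hp₁⟩ := hω₁.exists_centre
  obtain ⟨p₂, hp₂⟩ := hω₂.exists_centre
  set θ := max (angularDist ω₁ ω₂) (max r₁ r₂) with hθ
  have hdist : angularDist ω₁ ω₂ ≤ θ := le_max_left _ _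
  have hr₁θ : r₁ ≤ θ := (le_max_left _ _).trans (le_max_right _ _)
  have hr₂θ : r₂ ≤ θ := (le_max_right _ _).trans (le_max_right _ _)
  have hθ0 : 0 < θ := hω₁.1.trans_le hr₁θ
  have hθ4 : θ ≤ 4 := max_le ((angularDist_le_pi hp₁ hp₂).trans Real.pi_le_four)
    (max_le (by linarith) (by linarith))
  have hang : InnerProductGeometry.angle p₁ p₂ ≤ 3 * θ := by
    have := angle_centres_le hp₁ hp₂
    linarith
  obtain ⟨K, a, b, hK, hKi, ha, hb, hKb, hKr⟩ := hker H m hm ω₁ ω₂ r₁ r₂ p₁ p₂ k₁ k₂ θ hp₁ hp₂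
    hr₁ hr₂ hr₁θ hr₂θ hθ0 hθ4 hang
  have hrep := bilinearOp_eq_integral hK hT hKi ha hb m f₁ f₂
    (fun ξ η hξ hη => hKr ξ (hf₁ (subset_tsupport _ hξ)) η (hf₂ (subset_tsupport _ hη)))
  rw [funext hrep]
  refine (eLpNorm_integral_translates_le hK hT ha.measurable hb.measurable f₁.continuous
    f₂.continuous hp hpq).trans ?_
  rw [mul_assoc]
  gcongr
  refine hKb.trans (ENNReal.ofReal_le_ofReal ?_)
  gcongr
  linarith

end NullForm

theorem proposition7p6 (d : ℕ) (hd : 2 ≤ d)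
    (A : ℕ → ℕ → ℝ) (B : (Fin d → ℕ) → (Fin d → ℕ) → ℝ) :
    ∃ C : ℝ, 0 < C ∧
      ∀ (F₁ F₂ G : Type*)
        [NormedAddCommGroup F₁] [NormedSpace ℂ F₁] [FiniteDimensional ℂ F₁]
        [NormedAddCommGroup F₂] [NormedSpace ℂ F₂] [FiniteDimensional ℂ F₂]
        [NormedAddCommGroup G] [NormedSpace ℂ G] [FiniteDimensional ℂ G]
        (m : NullForm.Rd d × NullForm.Rd d → (F₁ →L[ℂ] F₂ →L[ℂ] G)),
        NullForm.IsAbstractNullForm A B m →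
      ∀ (ω₁ ω₂ : Set (NullForm.Rd d)) (r₁ r₂ : ℝ),
        NullForm.IsAngularCap ω₁ r₁ → NullForm.IsAngularCap ω₂ r₂ →
        r₁ ≤ (2 : ℝ) ^ (-10 : ℤ) → r₂ ≤ (2 : ℝ) ^ (-10 : ℤ) →
      ∀ (k₁ k₂ : ℤ) (f₁ : 𝓢(NullForm.Rd d, F₁)) (f₂ : 𝓢(NullForm.Rd d, F₂)),
        tsupport (NullForm.hat f₁) ⊆ NullForm.sector k₁ ω₁ →
        tsupport (NullForm.hat f₂) ⊆ NullForm.sector k₂ ω₂ →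
      ∀ p q₁ q₂ : ℝ≥0∞, 1 ≤ p → 1 ≤ q₁ → 1 ≤ q₂ → p⁻¹ = q₁⁻¹ + q₂⁻¹ →
        eLpNorm (NullForm.bilinearOp m f₁ f₂) p volume ≤
          ENNReal.ofReal (C * max (NullForm.angularDist ω₁ ω₂) (max r₁ r₂)) *
            eLpNorm f₁ q₁ volume * eLpNorm f₂ q₂ volume := by
  obtain ⟨C, hC, h⟩ := NullForm.exists_eLpNorm_bilinearOp_le (by omega : 0 < d) A B
  refine ⟨C, hC, ?_⟩
  intro F₁ F₂ G _ _ _ _ _ _ _ _ _ m hm ω₁ ω₂ r₁ r₂ hω₁ hω₂ hr₁ hr₂ k₁ k₂ f₁ f₂ hf₁ hf₂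
    p q₁ q₂ hp _ _ hpq
  have := FiniteDimensional.complete ℂ F₁
  have := FiniteDimensional.complete ℂ F₂
  have := FiniteDimensional.complete ℂ G
  have h10 : (2 : ℝ) ^ (-10 : ℤ) ≤ 1 := by norm_num
  -- applied in two steps, which keeps unifying the norms on `F₁ →L[ℂ] F₂ →L[ℂ] G` cheap
  have h' := h (F₁ →L[ℂ] F₂ →L[ℂ] G) F₁ F₂ G (ContinuousLinearMap.id ℂ (F₁ →L[ℂ] F₂ →L[ℂ] G))
  have h'' := h' (fun b u v => b.le_opNorm₂ u v) m hm ω₁ ω₂ r₁ r₂ hω₁ hω₂ (hr₁.trans h10)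
    (hr₂.trans h10)
  exact h'' k₁ k₂ f₁ f₂ hf₁ hf₂ p q₁ q₂ hp hpq

end
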